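/- **Theorem 4.7.** Let $M(N)$ be the space of complex $N\times N$ matrices and let $T:M(N)\to M(N)$ be a positive linear operator, i.e. $T(X)\succeq 0$ whenever $X\succeq 0$. Let $T^*$ be the dual of $T$ with respect to $\langle X,Y\rangle=\operatorname{tr}(XY^\dagger)$. Call $T$ *doubly stochastic* if $T(I)=I$ and $T^*(I)=I$, and *indecomposable* if $\operatorname{Rank}T(X)>\operatorname{Rank}X$ for all $X\succeq 0$ with $1\le\operatorname{Rank}X<N$. Put $S_{C_1,C_2}(T)(X)=C_1T(C_2^\dagger XC_2)C_1^\dagger$, $$\operatorname{Cap}(T)=\inf\{\det T(X): X\succ 0,\ \det X=1\},\qquad DS(T)=\operatorname{tr}\big((T(I)-I)^2\big)+\operatorname{tr}\big((T^*(I)-I)^2\big).$$ 1. (a) There exist nonsingular $C_1,C_2\in M(N)$ such that $S_{C_1,C_2}(T)$ is doubly stochastic if and only if $\operatorname{Cap}(T)>0$ and the infimum defining $\operatorname{Cap}(T)$ is attained. (b) If $\operatorname{Cap}(T)>0$ and $\operatorname{Cap}(T)=\det T(C)$ with $C\succ 0$, $\det C=1$, then $S_{T(C)^{-1/2},\,C^{1/2}}(T)$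 is doubly stochastic. (c) $T$ is indecomposable if and only if the infimum defining $\operatorname{Cap}(T)$ is attained at exactly one $C\succ 0$ with $\det C=1$. 2. If $T$ is doubly stochastic, then $T$ is indecomposable if and only if there is $0\le a<1$ such that $\operatorname{tr}\big(T(X)^2\big)\le a\,\operatorname{tr}(X^2)$ for all Hermitian $X$ with $\operatorname{tr}X=0$. 3. Suppose that $T$ is indecomposable and $T\ne 0$. Let $T_0=T$, $T_{n+1}=S_{T_n(I)^{-1/2},\,I}(T_n)$ for even $n$ and $T_{n+1}=S_{I,\,T_n^*(I)^{-1/2}}(T_n)$ for odd $n$ (operator Sinkhorn iterative scaling). Then $T_n(I)$ and $T_n^*(I)$ are nonsingular for every $n$, so that the iteration is well defined, and there are $K$ and $0\le a<1$ with $DS(T_n)\le K a^n$ for all $n\ge 0$. -/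

import Mathlib

open scoped ComplexOrder

namespace OperatorScaling

/-- `M(N)`: the complex `N × N` matrices. -/
abbrev Mat (N : ℕ) : Type := Matrix (Fin N) (Fin N) ℂ

/-- Linear operators `M(N) → M(N)`. -/
abbrev Op (N : ℕ) : Type := Mat N →ₗ[ℂ] Mat N

/-- `T` is positive: it maps positive semidefinite matrices to positive semidefinite ones. -/
def IsPositive {N : ℕ} (T : Op N) : Prop :=
  ∀ X : Mat N, X.PosSemidef → (T X).PosSemidef

/-- The dual `T^*` with respect to the inner product `⟨X, Y⟩ = tr (X Yᴴ)`, given by its entries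
`T^*(Y) i j = tr (Y (T E_{ij})ᴴ)`; see `trace_mul_dual` for the defining property. -/
def dual {N : ℕ} (T : Op N) : Op N where
  toFun Y := Matrix.of fun i j => (Y * (T (Matrix.single i j 1)).conjTranspose).trace
  map_add' Y Z := by
    ext i j
    simp [Matrix.add_mul]
  map_smul' c Y := by
    ext i j
    simp

/-- The defining property of the dual: `⟨T X, Y⟩ = ⟨X, T^* Y⟩`. -/
theorem trace_mul_dual {N : ℕ} (T : Op N) (X Y : Mat N) :
    (T X * Y.conjTranspose).trace = (X * (dual T Y).conjTranspose).trace := by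
  have key : ∀ i j, (dual T Y).conjTranspose j i
      = (T (Matrix.single i j 1) * Y.conjTranspose).trace := by
    intro i j
    have h : (dual T Y).conjTranspose j i
        = star ((Y * (T (Matrix.single i j 1)).conjTranspose).trace) := rfl
    rw [h, ← Matrix.trace_conjTranspose, Matrix.conjTranspose_mul,
      Matrix.conjTranspose_conjTranspose]
  have hX : T X = ∑ i, ∑ j, X i j • T (Matrix.single i j 1) := by
    conv_lhs => rw [Matrix.matrix_eq_sum_single X]
    simp only [map_sum]
    refine Finset.sum_congr rfl fun i _ => Finset.sum_congr rfl fun j _ => ?_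
    rw [← map_smul, Matrix.smul_single, smul_eq_mul, mul_one]
  have hR : (X * (dual T Y).conjTranspose).trace
      = ∑ i, ∑ j, X i j * (dual T Y).conjTranspose j i := by
    simp only [Matrix.trace, Matrix.diag_apply, Matrix.mul_apply]
  rw [hR, hX]
  simp only [key, Finset.sum_mul, Matrix.trace_sum, Matrix.smul_mul, Matrix.trace_smul,
    smul_eq_mul]

/-- `T` is indecomposable: `Rank (T X) > Rank X` for all `X ⪰ 0` with `1 ≤ Rank X < N`. -/
def IsIndecomposable {N : ℕ} (T : Op N) : Prop :=
  ∀ X : Mat N, X.PosSemidef → 1 ≤ X.rank → X.rank < N → X.rank < (T X).rank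

/-- `T` is doubly stochastic: `T(I) = I` and `T^*(I) = I`. -/
def IsDoublyStochastic {N : ℕ} (T : Op N) : Prop :=
  T 1 = 1 ∧ dual T 1 = 1

/-- `DS(T) = tr ((T(I) - I)²) + tr ((T^*(I) - I)²)` (a real number when `T` is positive). -/
noncomputable def DS {N : ℕ} (T : Op N) : ℝ :=
  (((T 1 - 1) ^ 2).trace + ((dual T 1 - 1) ^ 2).trace).re

/-- Operator scaling: `S_{C₁,C₂}(T)(X) = C₁ T(C₂ᴴ X C₂) C₁ᴴ`. -/
def scaling {N : ℕ} (C₁ C₂ : Mat N) (T : Op N) : Op N where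
  toFun X := C₁ * T (C₂.conjTranspose * X * C₂) * C₁.conjTranspose
  map_add' X Y := by
    simp [Matrix.mul_add, Matrix.add_mul]
  map_smul' c X := by
    simp

/-- The real power `A ^ s` of a Hermitian matrix, through its spectral decomposition
(used for positive definite `A` and `s = ± 1/2`). -/
noncomputable def power {N : ℕ} (A : Mat N) (s : ℝ) : Mat N :=
  cfc (fun x : ℝ => x ^ s) A

/-- Row scaling `R(T) = S_{T(I)^{-1/2}, I}(T)`. -/
noncomputable def rowScaling {N : ℕ} (T : Op N) : Op N :=
  scaling (power (T 1) (-1 / 2)) 1 T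

/-- Column scaling `C(T) = S_{I, T^*(I)^{-1/2}}(T)`. -/
noncomputable def colScaling {N : ℕ} (T : Op N) : Op N :=
  scaling 1 (power (dual T 1) (-1 / 2)) T

/-- Operator Sinkhorn iterative scaling `… C R C R (T)`: `T₀ = T`, `T₁ = R(T₀)`, `T₂ = C(T₁)`,
`T₃ = R(T₂)` and so on. -/
noncomputable def OSI {N : ℕ} (T : Op N) : ℕ → Op N
  | 0 => T
  | n + 1 => if Even n then rowScaling (OSI T n) else colScaling (OSI T n)

/-- The row and column scalings of `T` are defined: `T(I)` and `T^*(I)` are nonsingular. -/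
def HasNonsingularMarginals {N : ℕ} (T : Op N) : Prop :=
  IsUnit (T 1).det ∧ IsUnit (dual T 1).det

/-- `Cap(T) = inf {Det (T X) : X ≻ 0, Det X = 1}`. For positive `T` these determinants are
nonnegative reals. -/
noncomputable def capacity {N : ℕ} (T : Op N) : ℝ :=
  sInf {d : ℝ | ∃ X : Mat N, X.PosDef ∧ X.det = 1 ∧ d = (T X).det.re}

/-- The infimum defining `Cap(T)` is attained at `C`. -/
def IsMinimizer {N : ℕ} (T : Op N) (C : Mat N) : Prop :=
  C.PosDef ∧ C.det = 1 ∧ capacity T = (T C).det.re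

end OperatorScaling

namespace OperatorScaling

open Matrix

variable {N : ℕ}

/-! Doubly stochastic operators are reduced to classical doubly stochastic matrices. If `D` is
doubly stochastic, `X = U diag(d) Uᴴ` and `D X = V diag(e) Vᴴ`, then the numbers `⟨v_j, D(u_i u_iᴴ)
v_j⟩` form a doubly stochastic matrix `A` with `e = d A` (`IsDoublyStochastic.transition_mem`,
`vecMul_transition_eq`). Jensen's inequality compares the two spectra, and `variance A d` measures
its defect: it equals `tr X² - tr (D X)²`, and it vanishes when `det D(X) = det X` for `X ≻ 0`.
Indecomposability makes `A` strictly enlarge supports, so zero variance forces `X` to be scalar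
(`const_of_variance_eq_zero`). Hence `det D(X) ≥ det X` with equality only at scalars, and
compactness gives the gap on traceless matrices. Conversely, a decomposable `D` maps some nontrivial
projection to one of the same rank (`IsDoublyStochastic.exists_projection`), which destroys both the
gap and uniqueness.

For general `T`, a minimizer `C` of `det T(X) / det X` with `T(C) ≻ 0` satisfies `T^*(T(C)⁻¹) = C⁻¹`
(`Optimal.dual_inv`), which says exactly that the scaling by `T(C)^{-1/2}` and `C^{1/2}` is doubly
stochastic. Minimizers transport back through scalings (`Optimal.of_scaling`), so scalability and
attainment of a positive capacity coincide. An indecomposable `T` has a minimizer: the perturbations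
`T + ε tr(·) I` have minimizers by compactness, and their critical equations survive the limit as a
doubly stochastic weight matrix, whose column supports would contradict rank expansion if the limit
were singular (`exists_optimal_of_indecomposable`).

For Sinkhorn scaling, write `T` as a scaling of a doubly stochastic `D`; every iterate is again a
scaling of `D`, with factors `A_n`, `B_n`. The potential `-log |det A_n|² - log |det B_n|²` is
nonnegative after the first step and each later step lowers it by at least a multiple of `DS`
(`DS_le_potential_sub`). The gap of `D` gives a converse bound of the potential by `DS` at
row-normalized iterates (`exists_potential_le_DS`), uniformly because `B_nᴴ B_n` never leaves a
fixed order interval (`rightFactor_bound`). Together these contract the potential geometrically. -/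

/-- The matrix `U diag(d) Uᴴ`. -/
noncomputable def conjDiag (U : Mat N) (d : Fin N → ℝ) : Mat N :=
  U * diagonal (fun i => (d i : ℂ)) * Uᴴ

theorem exists_conjDiag {X : Mat N} (hX : X.IsHermitian) :
    ∃ (U : Mat N) (d : Fin N → ℝ), Uᴴ * U = 1 ∧ X = conjDiag U d := by
  refine ⟨hX.eigenvectorUnitary, hX.eigenvalues, ?_, ?_⟩
  · exact Unitary.coe_star_mul_self _
  · conv_lhs => rw [hX.spectral_theorem]
    rfl

/-! ### Calculus of matrices diagonal in a fixed unitary basis -/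

section conjDiag

variable {U : Mat N} {d e : Fin N → ℝ}

theorem conjTranspose_conjDiag_mul (hU : Uᴴ * U = 1) :
    Uᴴ * conjDiag U d * U = diagonal (fun i => (d i : ℂ)) := by
  have : Uᴴ * conjDiag U d * U = (Uᴴ * U) * diagonal (fun i => (d i : ℂ)) * (Uᴴ * U) := by
    simp only [conjDiag, Matrix.mul_assoc]
  rw [this, hU, Matrix.one_mul, Matrix.mul_one]

theorem isHermitian_conjDiag : (conjDiag U d).IsHermitian := by
  apply isHermitian_mul_mul_conjTranspose
  rw [isHermitian_diagonal_iff]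
  intro i
  exact Complex.conj_ofReal _

theorem trace_conjDiag (hU : Uᴴ * U = 1) : (conjDiag U d).trace = ((∑ i, d i : ℝ) : ℂ) := by
  rw [conjDiag, Matrix.mul_assoc, Matrix.trace_mul_comm, Matrix.mul_assoc, hU, Matrix.mul_one,
    trace_diagonal]
  push_cast
  rfl

theorem det_conjDiag (hU : Uᴴ * U = 1) : (conjDiag U d).det = ((∏ i, d i : ℝ) : ℂ) := by
  rw [conjDiag, det_mul_right_comm, det_mul, mul_eq_one_comm.mp hU, det_one, one_mul, det_diagonal]
  push_cast
  rfl

theorem isUnit_det_of_mul_eq_one {A B : Mat N} (h : A * B = 1) : IsUnit A.det ∧ IsUnit B.det := by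
  have : A.det * B.det = 1 := by rw [← det_mul, h, det_one]
  exact ⟨IsUnit.of_mul_eq_one _ this, IsUnit.of_mul_eq_one_right _ this⟩

theorem rank_conjDiag (hU : Uᴴ * U = 1) :
    (conjDiag U d).rank = (Finset.univ.filter fun i => d i ≠ 0).card := by
  have h := isUnit_det_of_mul_eq_one hU
  rw [conjDiag, rank_mul_eq_left_of_isUnit_det _ _ h.1, rank_mul_eq_right_of_isUnit_det _ _ h.2,
    rank_diagonal, Fintype.card_subtype]
  simp

theorem conjDiag_mul (hU : Uᴴ * U = 1) :
    conjDiag U d * conjDiag U e = conjDiag U (fun i => d i * e i) := by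
  have : conjDiag U d * conjDiag U e = U * diagonal (fun i => (d i : ℂ)) * (Uᴴ * U) *
      diagonal (fun i => (e i : ℂ)) * Uᴴ := by
    simp only [conjDiag, Matrix.mul_assoc]
  rw [this, hU, Matrix.mul_one, Matrix.mul_assoc U, diagonal_mul_diagonal, conjDiag]
  push_cast
  rfl

theorem conjDiag_add : conjDiag U d + conjDiag U e = conjDiag U (fun i => d i + e i) := by
  rw [conjDiag, conjDiag, conjDiag, ← Matrix.add_mul, ← Matrix.mul_add, diagonal_add]
  push_cast
  rfl

theorem conjDiag_sub : conjDiag U d - conjDiag U e = conjDiag U (fun i => d i - e i) := by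
  rw [conjDiag, conjDiag, conjDiag, ← Matrix.sub_mul, ← Matrix.mul_sub, diagonal_sub]
  push_cast
  rfl

theorem conjDiag_const (hU : Uᴴ * U = 1) (c : ℝ) : conjDiag U (fun _ => c) = (c : ℂ) • 1 := by
  have : diagonal (fun _ : Fin N => (c : ℂ)) = (c : ℂ) • (1 : Mat N) := by
    rw [smul_one_eq_diagonal]
  rw [conjDiag, this, Matrix.mul_smul, Matrix.mul_one, Matrix.smul_mul, mul_eq_one_comm.mp hU]

theorem conjDiag_smul (c : ℝ) : (c : ℂ) • conjDiag U d = conjDiag U (fun i => c * d i) := by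
  rw [conjDiag, conjDiag, ← Matrix.smul_mul, ← Matrix.mul_smul, ← diagonal_smul]
  congr 3
  ext i
  simp

theorem posSemidef_conjDiag (hd : ∀ i, 0 ≤ d i) : (conjDiag U d).PosSemidef := by
  apply PosSemidef.mul_mul_conjTranspose_same
  rw [posSemidef_diagonal_iff]
  intro i
  exact_mod_cast hd i

theorem posSemidef_conjDiag_iff (hU : Uᴴ * U = 1) : (conjDiag U d).PosSemidef ↔ ∀ i, 0 ≤ d i := by
  refine ⟨fun h i => ?_, posSemidef_conjDiag⟩
  have h2 := h.conjTranspose_mul_mul_same U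
  rw [conjTranspose_conjDiag_mul hU, posSemidef_diagonal_iff] at h2
  exact_mod_cast h2 i

theorem posDef_conjDiag_iff (hU : Uᴴ * U = 1) : (conjDiag U d).PosDef ↔ ∀ i, 0 < d i := by
  have hu : IsUnit U := (isUnit_iff_isUnit_det _).mpr (isUnit_det_of_mul_eq_one hU).2
  have := (IsUnit.posDef_star_right_conjugate_iff (x := diagonal (fun i => (d i : ℂ))) hu)
  rw [star_eq_conjTranspose] at this
  rw [conjDiag, this, posDef_diagonal_iff]
  exact forall_congr' fun i => by norm_cast

end conjDiag

/-! ### Positive semidefinite matrices -/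

theorem exists_posDef_bound {X : Mat N} (hX : X.PosDef) :
    ∃ m : ℝ, 0 < m ∧ (X - (m : ℂ) • 1).PosSemidef := by
  obtain ⟨U, d, hU, rfl⟩ := exists_conjDiag hX.isHermitian
  rw [posDef_conjDiag_iff hU] at hX
  obtain ⟨m, hm, h⟩ : ∃ m : ℝ, 0 < m ∧ ∀ i, m ≤ d i := by
    rcases isEmpty_or_nonempty (Fin N) with h | h
    · exact ⟨1, one_pos, fun i => h.elim i⟩
    · obtain ⟨i, hi⟩ := Finite.exists_min d
      exact ⟨d i, hX i, hi⟩
  refine ⟨m, hm, ?_⟩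
  rw [← conjDiag_const hU, conjDiag_sub]
  exact posSemidef_conjDiag fun i => sub_nonneg.mpr (h i)

theorem exists_hermitian_bound {X : Mat N} (hX : X.IsHermitian) :
    ∃ M : ℝ, 0 < M ∧ ((M : ℂ) • 1 - X).PosSemidef := by
  obtain ⟨U, d, hU, rfl⟩ := exists_conjDiag hX
  obtain ⟨M, hM, h⟩ : ∃ M : ℝ, 0 < M ∧ ∀ i, d i ≤ M := by
    rcases isEmpty_or_nonempty (Fin N) with h | h
    · exact ⟨1, one_pos, fun i => h.elim i⟩
    · obtain ⟨i, hi⟩ := Finite.exists_max d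
      exact ⟨max 1 (d i), by positivity, fun j => (hi j).trans (le_max_right _ _)⟩
  refine ⟨M, hM, ?_⟩
  rw [← conjDiag_const hU, conjDiag_sub]
  exact posSemidef_conjDiag fun i => sub_nonneg.mpr (h i)

theorem posDef_of_bound {X : Mat N} {m : ℝ} (hm : 0 < m) (h : (X - (m : ℂ) • 1).PosSemidef) :
    X.PosDef := by
  have h1 : ((m : ℂ) • (1 : Mat N)).PosDef := PosDef.one.smul (by exact_mod_cast hm)
  simpa using h1.posSemidef_add h

theorem conjDiag_bound_iff {U : Mat N} {d : Fin N → ℝ} (hU : Uᴴ * U = 1) (m : ℝ) :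
    (conjDiag U d - (m : ℂ) • 1).PosSemidef ↔ ∀ i, m ≤ d i := by
  rw [← conjDiag_const hU, conjDiag_sub, posSemidef_conjDiag_iff hU]
  simp

theorem conjDiag_bound_iff' {U : Mat N} {d : Fin N → ℝ} (hU : Uᴴ * U = 1) (m : ℝ) :
    ((m : ℂ) • 1 - conjDiag U d).PosSemidef ↔ ∀ i, d i ≤ m := by
  rw [← conjDiag_const hU, conjDiag_sub, posSemidef_conjDiag_iff hU]
  simp

theorem trace_mul_nonneg {P Q : Mat N} (hP : P.PosSemidef) (hQ : Q.PosSemidef) :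
    0 ≤ (P * Q).trace := by
  obtain ⟨U, d, hU, rfl⟩ := exists_conjDiag hP.isHermitian
  rw [posSemidef_conjDiag_iff hU] at hP
  have h := hQ.conjTranspose_mul_mul_same U
  rw [conjDiag, Matrix.mul_assoc, Matrix.trace_mul_cycle, Matrix.trace_mul_comm, trace]
  refine Finset.sum_nonneg fun i _ => ?_
  rw [diag_apply, diagonal_mul]
  exact mul_nonneg (by exact_mod_cast hP i) h.diag_nonneg

theorem inv_conjDiag {U : Mat N} {d : Fin N → ℝ} (hU : Uᴴ * U = 1) (hd : ∀ i, d i ≠ 0) :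
    (conjDiag U d)⁻¹ = conjDiag U (fun i => (d i)⁻¹) := by
  apply inv_eq_right_inv
  rw [conjDiag_mul hU]
  simp only [mul_inv_cancel₀ (hd _)]
  rw [conjDiag_const hU]
  simp

theorem rank_le_of_ker_le {A B : Mat N} (h : ∀ v, B *ᵥ v = 0 → A *ᵥ v = 0) :
    A.rank ≤ B.rank := by
  have h1 := A.mulVecLin.finrank_range_add_finrank_ker
  have h2 := B.mulVecLin.finrank_range_add_finrank_ker
  have h3 : Module.finrank ℂ B.mulVecLin.ker ≤ Module.finrank ℂ A.mulVecLin.ker := by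
    apply Submodule.finrank_mono
    intro v hv
    exact h v hv
  rw [Matrix.rank, Matrix.rank]
  omega

theorem mulVec_eq_zero_of_posSemidef_sub {A B : Mat N} (hA : A.PosSemidef)
    (hAB : (B - A).PosSemidef) {v : Fin N → ℂ} (h : B *ᵥ v = 0) : A *ᵥ v = 0 := by
  rw [← hA.dotProduct_mulVec_zero_iff]
  apply le_antisymm _ (hA.dotProduct_mulVec_nonneg v)
  have := hAB.dotProduct_mulVec_nonneg v
  rw [sub_mulVec, h, zero_sub, dotProduct_neg] at this
  simpa using this

/-! ### Powers of positive definite matrices -/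

theorem isHermitian_power (A : Mat N) (s : ℝ) : (power A s).IsHermitian :=
  (cfc_predicate (fun x : ℝ => x ^ s) A : IsSelfAdjoint _)

theorem pos_of_mem_spectrum {A : Mat N} (hA : A.PosDef) {x : ℝ} (hx : x ∈ spectrum ℝ A) :
    0 < x := by
  rw [hA.isHermitian.spectrum_real_eq_range_eigenvalues] at hx
  obtain ⟨i, rfl⟩ := hx
  exact hA.eigenvalues_pos i

theorem power_mul_power {A : Mat N} (hA : A.PosDef) (s t : ℝ) :
    power A s * power A t = power A (s + t) := by
  -- The spectrum is finite, so even the negative powers are continuous on it.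
  have hc : ∀ f : ℝ → ℝ, ContinuousOn f (spectrum ℝ A) := fun f =>
    (finite_real_spectrum (A := A)).continuousOn f
  rw [power, power, power, ← cfc_mul _ _ A (hc _) (hc _)]
  refine cfc_congr fun x hx => ?_
  exact (Real.rpow_add (pos_of_mem_spectrum hA hx) s t).symm

theorem power_one {A : Mat N} (hA : A.PosDef) : power A 1 = A := by
  rw [power]
  simp only [Real.rpow_one]
  exact cfc_id' ℝ A hA.isHermitian

theorem power_zero {A : Mat N} (hA : A.PosDef) : power A 0 = 1 := by
  rw [power]
  simp only [Real.rpow_zero]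
  exact cfc_const_one ℝ A hA.isHermitian

theorem power_half_mul_self {A : Mat N} (hA : A.PosDef) : power A (1 / 2) * power A (1 / 2) = A := by
  rw [power_mul_power hA, add_halves, power_one hA]

theorem power_neg_half_mul_mul {A : Mat N} (hA : A.PosDef) :
    power A (-1 / 2) * A * power A (-1 / 2) = 1 := by
  nth_rw 2 [← power_one hA]
  rw [power_mul_power hA, power_mul_power hA, ← power_zero hA]
  norm_num

theorem power_neg_half_mul_self {A : Mat N} (hA : A.PosDef) :
    power A (-1 / 2) * power A (-1 / 2) = A⁻¹ := by
  symm
  apply inv_eq_right_inv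
  nth_rw 1 [← power_one hA]
  rw [power_mul_power hA, power_mul_power hA, ← power_zero hA]
  norm_num

theorem isUnit_det_power {A : Mat N} (hA : A.PosDef) (s : ℝ) : IsUnit (power A s).det := by
  refine (isUnit_det_of_mul_eq_one (B := power A (-s)) ?_).1
  rw [power_mul_power hA, add_neg_cancel, power_zero hA]

end OperatorScaling
namespace OperatorScaling

open Matrix

variable {N : ℕ}

/-! ### Positive operators -/

theorem scaling_apply (C₁ C₂ : Mat N) (T : Op N) (X : Mat N) :
    scaling C₁ C₂ T X = C₁ * T (C₂ᴴ * X * C₂) * C₁ᴴ := rfl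

theorem scaling_scaling (A B C D : Mat N) (T : Op N) :
    scaling A B (scaling C D T) = scaling (A * C) (B * D) T := by
  ext1 X
  simp only [scaling_apply, conjTranspose_mul, Matrix.mul_assoc]

theorem scaling_one (T : Op N) : scaling 1 1 T = T := by
  ext1 X
  simp [scaling_apply]

namespace IsPositive

variable {T : Op N} (hT : IsPositive T)
include hT

/-- A Hermitian `X` is a difference `M·1 - (M·1 - X)` of positive semidefinite matrices. -/
theorem isHermitian_map {X : Mat N} (hX : X.IsHermitian) : (T X).IsHermitian := by
  obtain ⟨M, hM, h⟩ := exists_hermitian_bound hX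
  have h1 : ((M : ℂ) • (1 : Mat N)).PosSemidef := PosSemidef.one.smul (by exact_mod_cast hM.le)
  have h2 := (hT _ h1).isHermitian.sub (hT _ h).isHermitian
  rwa [← map_sub, sub_sub_cancel] at h2

theorem map_conjTranspose (X : Mat N) : T Xᴴ = (T X)ᴴ := by
  have key : ∀ Y : Mat N, Yᴴ = Y → T Yᴴ = (T Y)ᴴ := fun Y hY => by
    rw [hY]
    exact (hT.isHermitian_map hY).symm
  have hA : (X + Xᴴ)ᴴ = X + Xᴴ := by
    rw [conjTranspose_add, conjTranspose_conjTranspose, add_comm]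
  have hB : (Complex.I • (X - Xᴴ))ᴴ = Complex.I • (X - Xᴴ) := by
    rw [conjTranspose_smul, conjTranspose_sub, conjTranspose_conjTranspose]
    simp only [RCLike.star_def, Complex.conj_I, neg_smul, smul_sub]
    abel
  have h1 := key _ hA
  have h2 := key _ hB
  rw [hA, map_add, conjTranspose_add] at h1
  rw [hB, map_smul, map_sub, conjTranspose_smul, conjTranspose_sub] at h2
  have h3 : T X - T Xᴴ = -((T X)ᴴ - (T Xᴴ)ᴴ) := by
    have := congrArg (fun Z => (-Complex.I) • Z) h2
    simpa [smul_smul, ← sub_eq_add_neg] using this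
  have h4 : (2 : ℂ) • T Xᴴ = (2 : ℂ) • (T X)ᴴ := by
    rw [two_smul, two_smul]
    calc T Xᴴ + T Xᴴ = T X + T Xᴴ - (T X - T Xᴴ) := by abel
      _ = _ := by rw [h1, h3]; abel
  exact smul_right_injective _ (two_ne_zero) h4

theorem map_le {A B : Mat N} (h : (B - A).PosSemidef) : (T B - T A).PosSemidef := by
  rw [← map_sub]
  exact hT _ h

theorem dual_conjTranspose (Y : Mat N) : dual T Yᴴ = (dual T Y)ᴴ := by
  ext i j
  have h1 : dual T Yᴴ i j = (Yᴴ * (T (Matrix.single i j 1))ᴴ).trace := rfl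
  have h2 : (dual T Y)ᴴ i j = star ((Y * (T (Matrix.single j i 1))ᴴ).trace) := rfl
  have h3 : Matrix.single j i (1 : ℂ) = (Matrix.single i j (1 : ℂ))ᴴ := by simp
  rw [h1, h2, ← trace_conjTranspose, conjTranspose_mul, conjTranspose_conjTranspose, h3,
    hT.map_conjTranspose, Matrix.trace_mul_comm]

theorem trace_map_mul (X Y : Mat N) : (T X * Y).trace = (X * dual T Y).trace := by
  have := trace_mul_dual T X Yᴴ
  rwa [hT.dual_conjTranspose, conjTranspose_conjTranspose, conjTranspose_conjTranspose] at this

/-- The quadratic form of `T^*(Y)` at `v` is `tr(T(v vᴴ) Y)`, the trace of a product of two positive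
semidefinite matrices. -/
theorem dual : IsPositive (dual T) := by
  intro Y hY
  refine PosSemidef.of_dotProduct_mulVec_nonneg ?_ fun v => ?_
  · have := hT.dual_conjTranspose Y
    rw [hY.isHermitian.eq] at this
    exact this.symm
  · have h1 : star v ⬝ᵥ (OperatorScaling.dual T Y *ᵥ v)
        = (vecMulVec v (star v) * OperatorScaling.dual T Y).trace := by
      rw [vecMulVec_mul, trace_vecMulVec, dotProduct_mulVec, dotProduct_comm]
    rw [h1, ← hT.trace_map_mul]
    exact trace_mul_nonneg (hT _ (posSemidef_vecMulVec_self_star v)) hY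

theorem dual_dual : OperatorScaling.dual (OperatorScaling.dual T) = T := by
  ext1 X
  rw [ext_iff_trace_mul_left]
  intro Y
  rw [← hT.dual.trace_map_mul, Matrix.trace_mul_comm, ← hT.trace_map_mul, Matrix.trace_mul_comm]

theorem scaling (C₁ C₂ : Mat N) : IsPositive (scaling C₁ C₂ T) := fun _ hX =>
  (hT _ (hX.conjTranspose_mul_mul_same C₂)).mul_mul_conjTranspose_same C₁

theorem dual_scaling_apply (C₁ C₂ Y : Mat N) :
    OperatorScaling.dual (OperatorScaling.scaling C₁ C₂ T) Y
      = C₂ * OperatorScaling.dual T (C₁ᴴ * Y * C₁) * C₂ᴴ := by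
  rw [ext_iff_trace_mul_left]
  intro X
  calc (X * OperatorScaling.dual (OperatorScaling.scaling C₁ C₂ T) Y).trace
      = (C₁ * T (C₂ᴴ * X * C₂) * C₁ᴴ * Y).trace := by
        rw [← (hT.scaling C₁ C₂).trace_map_mul, scaling_apply]
    _ = (T (C₂ᴴ * X * C₂) * (C₁ᴴ * Y * C₁)).trace := by
        rw [Matrix.mul_assoc C₁, Matrix.mul_assoc C₁, Matrix.trace_mul_comm]
        simp only [Matrix.mul_assoc]
    _ = (C₂ᴴ * X * C₂ * OperatorScaling.dual T (C₁ᴴ * Y * C₁)).trace := hT.trace_map_mul _ _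
    _ = (X * (C₂ * OperatorScaling.dual T (C₁ᴴ * Y * C₁) * C₂ᴴ)).trace := by
        rw [Matrix.mul_assoc C₂ᴴ, Matrix.mul_assoc C₂ᴴ, Matrix.trace_mul_comm]
        simp only [Matrix.mul_assoc]

theorem trace_map (X : Mat N) : (T X).trace = (X * OperatorScaling.dual T 1).trace := by
  rw [← hT.trace_map_mul, Matrix.mul_one]

/-- A positive operator with `T(I)` nonsingular preserves positive definiteness. -/
theorem posDef_map (h1 : (T 1).PosDef) {X : Mat N} (hX : X.PosDef) : (T X).PosDef := by
  obtain ⟨m, hm, h⟩ := exists_posDef_bound hX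
  have h2 := hT.map_le h
  rw [map_smul] at h2
  simpa using (h1.smul (a := (m : ℂ)) (by exact_mod_cast hm)).add_posSemidef h2

/-- A Hermitian `C` lies between multiples of `1`, so a kernel vector of `T(1)` is killed by `T(C)`
as well. -/
theorem posDef_map_one {C : Mat N} (hC : C.IsHermitian) (h : (T C).det ≠ 0) : (T 1).PosDef := by
  rw [(hT 1 PosSemidef.one).posDef_iff_det_ne_zero]
  intro h0
  apply h
  obtain ⟨v, hv, hv0⟩ := exists_mulVec_eq_zero_iff.mpr h0
  refine exists_mulVec_eq_zero_iff.mp ⟨v, hv, ?_⟩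
  obtain ⟨M, hM, hle⟩ := exists_hermitian_bound hC
  obtain ⟨M', hM', hle'⟩ := exists_hermitian_bound hC.neg
  -- `M·1 - C` is positive semidefinite and at most `(M + M')·1`, so its image inherits the kernel
  -- vector.
  have hz : T ((M : ℂ) • 1 - C) *ᵥ v = 0 := by
    refine mulVec_eq_zero_of_posSemidef_sub (B := T (((M + M' : ℝ) : ℂ) • 1)) (hT _ hle) ?_ ?_
    · apply hT.map_le
      convert hle' using 1
      push_cast
      rw [add_smul]
      abel
    · rw [map_smul, smul_mulVec, hv0, smul_zero]
  rw [map_sub, sub_mulVec, map_smul, smul_mulVec, hv0, smul_zero, zero_sub, neg_eq_zero] at hz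
  exact hz

end IsPositive

theorem IsDoublyStochastic.dual {T : Op N} (h : IsDoublyStochastic T) (hT : IsPositive T) :
    IsDoublyStochastic (dual T) :=
  ⟨h.2, by rw [hT.dual_dual]; exact h.1⟩

theorem IsIndecomposable.scaling {T : Op N} (hT : IsIndecomposable T) {C₁ C₂ : Mat N}
    (h₁ : IsUnit C₁.det) (h₂ : IsUnit C₂.det) : IsIndecomposable (scaling C₁ C₂ T) := by
  intro X hX h1 h2
  have e : (C₂ᴴ * X * C₂).rank = X.rank := by
    rw [rank_mul_eq_left_of_isUnit_det _ _ h₂, rank_mul_eq_right_of_isUnit_det]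
    rw [det_conjTranspose]
    exact h₂.star
  have e' : (OperatorScaling.scaling C₁ C₂ T X).rank = (T (C₂ᴴ * X * C₂)).rank := by
    rw [scaling_apply, rank_mul_eq_left_of_isUnit_det, rank_mul_eq_right_of_isUnit_det _ _ h₁]
    rw [det_conjTranspose]
    exact h₁.star
  rw [e', ← e]
  exact hT _ (hX.conjTranspose_mul_mul_same C₂) (by rwa [e]) (by rwa [e])

theorem scaling_inv_scaling {T : Op N} {C₁ C₂ : Mat N} (h₁ : IsUnit C₁.det) (h₂ : IsUnit C₂.det) :
    scaling C₁⁻¹ C₂⁻¹ (scaling C₁ C₂ T) = T := by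
  rw [scaling_scaling, nonsing_inv_mul _ h₁, nonsing_inv_mul _ h₂, scaling_one]

end OperatorScaling
namespace OperatorScaling

open Matrix

variable {N : ℕ}

/-! ### Doubly stochastic matrices -/

section Stochastic

variable {A : Matrix (Fin N) (Fin N) ℝ} (hA : A ∈ doublyStochastic ℝ (Fin N))
  (d : Fin N → ℝ)

/-- The total variance of `d` under the transition probabilities of `A`. -/
noncomputable def variance (A : Matrix (Fin N) (Fin N) ℝ) (d : Fin N → ℝ) : ℝ :=
  ∑ i, ∑ j, A i j * (d i - (d ᵥ* A) j) ^ 2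

include hA

theorem entry_nonneg (i j : Fin N) : 0 ≤ A i j := (mem_doublyStochastic_iff_sum.mp hA).1 i j

theorem sum_sub_sum (f g : Fin N → ℝ) :
    ∑ i, f i - ∑ j, g j = ∑ i, ∑ j, A i j * (f i - g j) := by
  obtain ⟨-, hr, hc⟩ := mem_doublyStochastic_iff_sum.mp hA
  simp only [mul_sub, Finset.sum_sub_distrib]
  congr 1
  · simp only [← Finset.sum_mul, hr, one_mul]
  · rw [Finset.sum_comm]
    simp only [← Finset.sum_mul, hc, one_mul]

/-- `(d ᵥ* A) j` is the mean of `d` for the probability weights in column `j`; deviations from it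
average to zero, and `c j` is constant on that column. -/
theorem sum_linear_eq_zero (c : Fin N → ℝ) :
    ∑ i, ∑ j, A i j * ((d i - (d ᵥ* A) j) * c j) = 0 := by
  obtain ⟨-, -, hc⟩ := mem_doublyStochastic_iff_sum.mp hA
  rw [Finset.sum_comm]
  refine Finset.sum_eq_zero fun j _ => ?_
  have h1 : ∑ i, A i j * ((d i - (d ᵥ* A) j) * c j)
      = (∑ i, d i * A i j - (∑ i, A i j) * (d ᵥ* A) j) * c j := by
    rw [Finset.sum_mul, ← Finset.sum_sub_distrib, Finset.sum_mul]
    exact Finset.sum_congr rfl fun i _ => by ring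
  rw [h1, hc, one_mul]
  have : ∑ i, d i * A i j = (d ᵥ* A) j := rfl
  rw [this, sub_self, zero_mul]

/-- The mechanism behind every Jensen-type estimate below: taking `c j` to be the derivative at the
mean of column `j` turns the difference of sums into a weighted sum of tangent-line remainders,
which can be estimated term by term. -/
theorem sum_sub_sum_eq (f g c : Fin N → ℝ) :
    ∑ i, f i - ∑ j, g j = ∑ i, ∑ j, A i j * (f i - g j - (d i - (d ᵥ* A) j) * c j) := by
  have h1 := sum_sub_sum hA f g
  have h2 := sum_linear_eq_zero hA d c
  rw [h1, ← sub_zero (∑ i, ∑ j, A i j * (f i - g j)), ← h2, ← Finset.sum_sub_distrib]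
  simp only [← Finset.sum_sub_distrib, ← mul_sub]

theorem variance_nonneg : 0 ≤ variance A d :=
  Finset.sum_nonneg fun i _ => Finset.sum_nonneg fun j _ =>
    mul_nonneg (entry_nonneg hA i j) (sq_nonneg _)

theorem eq_of_variance_eq_zero (h : variance A d = 0) (i j : Fin N) (hij : A i j ≠ 0) :
    d i = (d ᵥ* A) j := by
  have h0 : ∀ i j, 0 ≤ A i j * (d i - (d ᵥ* A) j) ^ 2 := fun i j =>
    mul_nonneg (entry_nonneg hA i j) (sq_nonneg _)
  have h1 := (Finset.sum_eq_zero_iff_of_nonneg fun i _ =>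
    Finset.sum_nonneg fun j _ => h0 i j).mp h i (Finset.mem_univ _)
  have h2 := (Finset.sum_eq_zero_iff_of_nonneg fun j _ => h0 i j).mp h1 j (Finset.mem_univ _)
  simpa [hij, sub_eq_zero] using h2

theorem sum_sq_sub_sum_sq : ∑ i, d i ^ 2 - ∑ j, (d ᵥ* A) j ^ 2 = variance A d := by
  rw [sum_sub_sum_eq hA d _ _ (fun j => 2 * (d ᵥ* A) j), variance]
  exact Finset.sum_congr rfl fun i _ => Finset.sum_congr rfl fun j _ => by ring

variable {d}

theorem le_vecMul {m : ℝ} (h : ∀ i, m ≤ d i) (j : Fin N) : m ≤ (d ᵥ* A) j := by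
  obtain ⟨h0, -, hc⟩ := mem_doublyStochastic_iff_sum.mp hA
  calc m = ∑ i, m * A i j := by rw [← Finset.mul_sum, hc, mul_one]
    _ ≤ ∑ i, d i * A i j := Finset.sum_le_sum fun i _ => mul_le_mul_of_nonneg_right (h i) (h0 i j)

theorem vecMul_le {M : ℝ} (h : ∀ i, d i ≤ M) (j : Fin N) : (d ᵥ* A) j ≤ M := by
  obtain ⟨h0, -, hc⟩ := mem_doublyStochastic_iff_sum.mp hA
  calc ∑ i, d i * A i j ≤ ∑ i, M * A i j :=
        Finset.sum_le_sum fun i _ => mul_le_mul_of_nonneg_right (h i) (h0 i j)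
    _ = M := by rw [← Finset.mul_sum, hc, mul_one]

theorem vecMul_pos (h : ∀ i, 0 < d i) (j : Fin N) : 0 < (d ᵥ* A) j := by
  have : Nonempty (Fin N) := ⟨j⟩
  obtain ⟨i, hi⟩ := Finite.exists_min d
  exact (h i).trans_le (le_vecMul hA hi j)

/-- Each tangent remainder is `log t - (t - 1)` with `t = d i / μ_j`, which is negative unless `t =
1`. -/
theorem sum_log_le_sum_log (h : ∀ i, 0 < d i) :
    ∑ i, Real.log (d i) ≤ ∑ j, Real.log ((d ᵥ* A) j) ∧
      (∑ i, Real.log (d i) = ∑ j, Real.log ((d ᵥ* A) j) → variance A d = 0) := by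
  have key := sum_sub_sum_eq hA d (fun i => Real.log (d i)) (fun j => Real.log ((d ᵥ* A) j))
    (fun j => ((d ᵥ* A) j)⁻¹)
  have hμ := vecMul_pos hA h
  have hterm : ∀ i j, Real.log (d i) - Real.log ((d ᵥ* A) j)
      - (d i - (d ᵥ* A) j) * ((d ᵥ* A) j)⁻¹ ≤ 0 ∧ (Real.log (d i) - Real.log ((d ᵥ* A) j)
      - (d i - (d ᵥ* A) j) * ((d ᵥ* A) j)⁻¹ = 0 → d i = (d ᵥ* A) j) := by
    intro i j
    have e : Real.log (d i) - Real.log ((d ᵥ* A) j) - (d i - (d ᵥ* A) j) * ((d ᵥ* A) j)⁻¹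
        = Real.log (d i / (d ᵥ* A) j) - (d i / (d ᵥ* A) j - 1) := by
      rw [Real.log_div (h i).ne' (hμ j).ne']
      have := (hμ j).ne'
      field_simp
    rw [e]
    have hp := div_pos (h i) (hμ j)
    refine ⟨sub_nonpos.mpr (Real.log_le_sub_one_of_pos hp), fun h0 => ?_⟩
    by_contra hne
    have := Real.log_lt_sub_one_of_pos hp (fun h1 => hne ((div_eq_one_iff_eq (hμ j).ne').mp h1))
    linarith
  have hn : ∀ i j, A i j * (Real.log (d i) - Real.log ((d ᵥ* A) j)
      - (d i - (d ᵥ* A) j) * ((d ᵥ* A) j)⁻¹) ≤ 0 := fun i j =>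
    mul_nonpos_of_nonneg_of_nonpos (entry_nonneg hA i j) (hterm i j).1
  refine ⟨?_, fun heq => ?_⟩
  · rw [← sub_nonpos, key]
    exact Finset.sum_nonpos fun i _ => Finset.sum_nonpos fun j _ => hn i j
  · rw [← sub_eq_zero, key] at heq
    refine Finset.sum_eq_zero fun i hi => Finset.sum_eq_zero fun j hj => ?_
    have h1 := (Finset.sum_eq_zero_iff_of_nonpos fun i _ =>
      Finset.sum_nonpos fun j _ => hn i j).mp heq i hi
    have h2 := (Finset.sum_eq_zero_iff_of_nonpos fun j _ => hn i j).mp h1 j hj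
    rcases mul_eq_zero.mp h2 with h3 | h3
    · rw [h3, zero_mul]
    · rw [(hterm i j).2 h3, sub_self]
      ring

/-- A reverse Jensen bound: applying `log t ≤ t - 1` to `μ / d` bounds the remainder by `(d - μ)² /
(d μ)`, and both factors in the denominator are at least `m`. -/
theorem sum_log_sub_sum_log_le {m : ℝ} (hm : 0 < m) (h : ∀ i, m ≤ d i) :
    ∑ j, Real.log ((d ᵥ* A) j) - ∑ i, Real.log (d i) ≤ (m ^ 2)⁻¹ * variance A d := by
  have key := sum_sub_sum_eq hA d (fun i => Real.log (d i)) (fun j => Real.log ((d ᵥ* A) j))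
    (fun j => ((d ᵥ* A) j)⁻¹)
  rw [← neg_sub, key, neg_le_iff_add_nonneg, variance, Finset.mul_sum, ← Finset.sum_add_distrib]
  refine Finset.sum_nonneg fun i _ => ?_
  rw [Finset.mul_sum, ← Finset.sum_add_distrib]
  refine Finset.sum_nonneg fun j _ => ?_
  have hμ := le_vecMul hA h j
  set μ := (d ᵥ* A) j
  have hd := h i
  have hd0 : 0 < d i := hm.trans_le hd
  have hμ0 : 0 < μ := hm.trans_le hμ
  have h1 : Real.log μ - Real.log (d i) ≤ μ / d i - 1 := by
    rw [← Real.log_div hμ0.ne' hd0.ne']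
    exact Real.log_le_sub_one_of_pos (div_pos hμ0 hd0)
  have h2 : μ / d i - 1 + (d i - μ) * μ⁻¹ = (d i * μ)⁻¹ * (d i - μ) ^ 2 := by
    field_simp
    ring
  have h3 : (d i * μ)⁻¹ * (d i - μ) ^ 2 ≤ (m ^ 2)⁻¹ * (d i - μ) ^ 2 := by
    apply mul_le_mul_of_nonneg_right _ (sq_nonneg _)
    apply inv_anti₀ (by positivity)
    nlinarith
  have h4 : 0 ≤ Real.log (d i) - Real.log μ - (d i - μ) * μ⁻¹ + (m ^ 2)⁻¹ * (d i - μ) ^ 2 := by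
    linarith
  nlinarith [mul_nonneg (entry_nonneg hA i j) h4]

/-- The tangent remainder of `x ↦ 1/x` at `μ` is exactly `(d - μ)² / (d μ²)`, and the denominator is
at most `M³`. -/
theorem variance_le_sum_inv_sub {M : ℝ} (hd : ∀ i, 0 < d i) (h : ∀ i, d i ≤ M) :
    (M ^ 3)⁻¹ * variance A d ≤ ∑ i, (d i)⁻¹ - ∑ j, ((d ᵥ* A) j)⁻¹ := by
  rw [sum_sub_sum_eq hA d (fun i => (d i)⁻¹) (fun j => ((d ᵥ* A) j)⁻¹)
    (fun j => -((d ᵥ* A) j ^ 2)⁻¹), variance, Finset.mul_sum]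
  refine Finset.sum_le_sum fun i _ => ?_
  rw [Finset.mul_sum]
  refine Finset.sum_le_sum fun j _ => ?_
  have hμ := vecMul_le hA h j
  have hμ0 := vecMul_pos hA hd j
  set μ := (d ᵥ* A) j
  have hd0 := hd i
  have hd1 := h i
  have hM0 : 0 ≤ M := hd0.le.trans hd1
  have h2 : (d i)⁻¹ - μ⁻¹ - (d i - μ) * -(μ ^ 2)⁻¹ = (d i * μ ^ 2)⁻¹ * (d i - μ) ^ 2 := by
    field_simp
    ring
  rw [h2, mul_left_comm]
  apply mul_le_mul_of_nonneg_left _ (entry_nonneg hA i j)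
  apply mul_le_mul_of_nonneg_right _ (sq_nonneg _)
  apply inv_anti₀ (by positivity)
  calc d i * μ ^ 2 ≤ M * M ^ 2 := by gcongr
    _ = M ^ 3 := by ring

omit hA in
-- Count mass: the columns in `R` receive total mass `|R|` from the rows in `S`, and those rows
-- carry at most `|S|`.
theorem card_le_card_of_sum_eq_one (h0 : ∀ i j, 0 ≤ A i j) (hr : ∀ i, ∑ j, A i j ≤ 1)
    (S R : Finset (Fin N)) (h : ∀ j ∈ R, ∑ i ∈ S, A i j = 1) : R.card ≤ S.card := by
  have h1 : (R.card : ℝ) ≤ S.card := calc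
    (R.card : ℝ) = ∑ j ∈ R, ∑ i ∈ S, A i j := by rw [Finset.sum_congr rfl h]; simp
    _ = ∑ i ∈ S, ∑ j ∈ R, A i j := Finset.sum_comm
    _ ≤ ∑ i ∈ S, ∑ j, A i j := Finset.sum_le_sum fun i _ =>
        Finset.sum_le_sum_of_subset_of_nonneg (Finset.subset_univ _) fun j _ _ => h0 i j
    _ ≤ ∑ i ∈ S, 1 := Finset.sum_le_sum fun i _ => hr i
    _ = S.card := by simp
  exact_mod_cast h1

/-- A vector of variance zero is constant if the matrix strictly expands supports. -/
theorem const_of_variance_eq_zero (hvar : variance A d = 0)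
    (hexp : ∀ S : Finset (Fin N), S.Nonempty → S ≠ Finset.univ →
      S.card < (Finset.univ.filter fun j => ∃ i ∈ S, A i j ≠ 0).card) (i k : Fin N) :
    d i = d k := by
  obtain ⟨h0, hr, hc⟩ := mem_doublyStochastic_iff_sum.mp hA
  have hmean := eq_of_variance_eq_zero hA d hvar
  -- At zero variance all rows that meet a given column share one value of `d`. A column met by this
  -- level set is therefore supported in it, so the level set cannot expand.
  set S := Finset.univ.filter fun l => d l = d k with hS
  by_cases hu : S = Finset.univ
  · have : i ∈ S := hu ▸ Finset.mem_univ i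
    simpa [hS] using this
  have h1 := hexp S ⟨k, by simp [hS]⟩ hu
  have h2 := card_le_card_of_sum_eq_one h0 (fun i => (hr i).le) S
    (Finset.univ.filter fun j => ∃ i ∈ S, A i j ≠ 0) ?_
  · omega
  · intro j hj
    obtain ⟨l, hl, hlj⟩ := (Finset.mem_filter.mp hj).2
    rw [← hc j]
    refine Finset.sum_subset (Finset.subset_univ _) fun i _ hi => ?_
    by_contra hij
    apply hi
    have e1 := hmean i j hij
    have e2 := hmean l j hlj
    have e3 : d l = d k := (Finset.mem_filter.mp hl).2
    exact Finset.mem_filter.mpr ⟨Finset.mem_univ _, by rw [e1, ← e2, e3]⟩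

end Stochastic

/-! ### The transition matrix of a positive operator -/

/-- The matrix with entries `⟨v_j, T(u_i u_iᴴ) v_j⟩`, where `u_i`, `v_j` are the columns of `U`
and `V`. -/
noncomputable def transition (T : Op N) (U V : Mat N) : Matrix (Fin N) (Fin N) ℝ :=
  Matrix.of fun i j => ((Vᴴ * T (conjDiag U (Pi.single i 1)) * V) j j).re

theorem conjDiag_eq_sum (U : Mat N) (d : Fin N → ℝ) :
    conjDiag U d = ∑ i, (d i : ℂ) • conjDiag U (Pi.single i 1) := by
  have h : diagonal (fun i => (d i : ℂ))
      = ∑ i, (d i : ℂ) • diagonal (fun k => ((Pi.single i 1 : Fin N → ℝ) k : ℂ)) := by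
    ext a b
    rw [Matrix.sum_apply]
    by_cases hab : a = b
    · subst hab
      simp [Pi.single_apply, apply_ite Complex.ofReal]
    · simp [hab]
  rw [conjDiag, h, Matrix.mul_sum, Matrix.sum_mul]
  simp only [conjDiag, Matrix.mul_smul, Matrix.smul_mul]

theorem vecMul_transition (T : Op N) (U V : Mat N) (d : Fin N → ℝ) (j : Fin N) :
    (d ᵥ* transition T U V) j = ((Vᴴ * T (conjDiag U d) * V) j j).re := by
  rw [conjDiag_eq_sum, map_sum, Matrix.mul_sum, Matrix.sum_mul, Matrix.sum_apply, Complex.re_sum]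
  simp [Matrix.vecMul, dotProduct, transition]

theorem transition_nonneg {T : Op N} (hT : IsPositive T) (U V : Mat N) (i j : Fin N) :
    0 ≤ transition T U V i j := by
  have h1 : (conjDiag U (Pi.single i 1)).PosSemidef := posSemidef_conjDiag fun k => by
    by_cases h : k = i
    · subst h; simp
    · simp [h]
  have h2 := ((hT _ h1).conjTranspose_mul_mul_same V).diag_nonneg (i := j)
  exact (Complex.le_def.mp h2).1

/-- Row sums are traces of images of rank-one projections, hence `1` by `T^*(I) = I`; column sums
are diagonal entries of `Vᴴ T(I) V`. -/
theorem IsDoublyStochastic.transition_mem {T : Op N} (h : IsDoublyStochastic T)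
    (hT : IsPositive T) {U V : Mat N} (hU : Uᴴ * U = 1) (hV : Vᴴ * V = 1) :
    transition T U V ∈ doublyStochastic ℝ (Fin N) := by
  rw [mem_doublyStochastic_iff_sum]
  refine ⟨transition_nonneg hT U V, fun i => ?_, fun j => ?_⟩
  · have h1 : ∑ j, transition T U V i j
        = (Vᴴ * T (conjDiag U (Pi.single i 1)) * V).trace.re := by
      rw [trace, Complex.re_sum]
      rfl
    rw [h1, Matrix.trace_mul_cycle, mul_eq_one_comm.mp hV, Matrix.one_mul, hT.trace_map, h.2,
      Matrix.mul_one, trace_conjDiag hU]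
    simp
  · have h1 := vecMul_transition T U V (fun _ => 1) j
    rw [conjDiag_const hU, Complex.ofReal_one, one_smul, h.1, Matrix.mul_one, hV] at h1
    simpa [Matrix.vecMul, dotProduct] using h1

theorem vecMul_transition_eq {T : Op N} {U V : Mat N} {d e : Fin N → ℝ} (hV : Vᴴ * V = 1)
    (h : T (conjDiag U d) = conjDiag V e) : d ᵥ* transition T U V = e := by
  ext j
  rw [vecMul_transition, h, conjTranspose_conjDiag_mul hV]
  simp

/-- Diagonal entries bound the rank of a positive semidefinite matrix. -/
theorem rank_le_card_diag {M V : Mat N} (hM : M.PosSemidef) (hV : Vᴴ * V = 1) :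
    M.rank ≤ (Finset.univ.filter fun j => (Vᴴ * M * V) j j ≠ 0).card := by
  have hv := isUnit_det_of_mul_eq_one hV
  have e : (Vᴴ * M * V).rank = M.rank := by
    rw [rank_mul_eq_left_of_isUnit_det _ _ hv.2, rank_mul_eq_right_of_isUnit_det _ _ hv.1]
  have hQ := hM.conjTranspose_mul_mul_same V
  rw [← e]
  set Q := Vᴴ * M * V
  -- A zero diagonal entry of a positive semidefinite matrix kills its whole column.
  have h1 : Q = Q * diagonal (fun j => if Q j j ≠ 0 then (1 : ℂ) else 0) := by
    ext i j
    rw [mul_diagonal]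
    split_ifs with h
    · rw [mul_one]
    · rw [mul_zero]
      have h2 : Q *ᵥ Pi.single j 1 = 0 := by
        rw [← hQ.dotProduct_mulVec_zero_iff]
        simpa using h
      have := congrFun h2 i
      simpa using this
  calc Q.rank ≤ (diagonal (fun j => if Q j j ≠ 0 then (1 : ℂ) else 0)).rank := by
        rw [h1]
        exact (rank_mul_le_right _ _).trans_eq (by rw [← h1])
    _ = _ := by
        rw [rank_diagonal, Fintype.card_subtype]
        simp

/-- The indicator function of a finite set of indices. -/
noncomputable def indicator (S : Finset (Fin N)) : Fin N → ℝ := fun i => if i ∈ S then 1 else 0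

theorem posSemidef_conjDiag_indicator (U : Mat N) (S : Finset (Fin N)) :
    (conjDiag U (indicator S)).PosSemidef :=
  posSemidef_conjDiag fun i => by rw [indicator]; split_ifs <;> norm_num

theorem rank_conjDiag_indicator {U : Mat N} (hU : Uᴴ * U = 1) (S : Finset (Fin N)) :
    (conjDiag U (indicator S)).rank = S.card := by
  rw [rank_conjDiag hU]
  congr 1
  ext i
  simp [indicator]

theorem card_lt_of_ne_univ {S : Finset (Fin N)} (h : S ≠ Finset.univ) : S.card < N := by
  simpa using Finset.card_lt_card (Finset.ssubset_univ_iff.mpr h)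

/-- The image of the projection onto the span of the `u_i`, `i ∈ S`, has rank above `|S|`. Its
diagonal entries in the basis `V` are the column sums of the transition matrix over `S`, and there
must be at least as many nonzero ones as the rank. -/
theorem IsIndecomposable.card_lt {T : Op N} (h : IsIndecomposable T) (hT : IsPositive T)
    {U V : Mat N} (hU : Uᴴ * U = 1) (hV : Vᴴ * V = 1) (S : Finset (Fin N)) (hS : S.Nonempty)
    (hS' : S ≠ Finset.univ) :
    S.card < (Finset.univ.filter fun j => ∃ i ∈ S, transition T U V i j ≠ 0).card := by
  have hP := posSemidef_conjDiag_indicator U S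
  have hr := rank_conjDiag_indicator hU S
  have h1 := h _ hP (by rw [hr]; exact hS.card_pos) (by rw [hr]; exact card_lt_of_ne_univ hS')
  rw [hr] at h1
  refine (h1.trans_le (rank_le_card_diag (hT _ hP) hV)).trans_le (Finset.card_le_card ?_)
  intro j hj
  rw [Finset.mem_filter] at hj ⊢
  refine ⟨hj.1, ?_⟩
  by_contra hcon
  push Not at hcon
  apply hj.2
  have hq := ((hT _ hP).conjTranspose_mul_mul_same V).diag_nonneg (i := j)
  have h2 := vecMul_transition T U V (indicator S) j
  have h3 : ∑ i, indicator S i * transition T U V i j = 0 := by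
    refine Finset.sum_eq_zero fun i _ => ?_
    by_cases hi : i ∈ S
    · rw [hcon i hi, mul_zero]
    · rw [indicator, if_neg hi, zero_mul]
  rw [show (indicator S ᵥ* transition T U V) j = _ from h3] at h2
  exact Complex.ext h2.symm (Complex.le_def.mp hq).2.symm

end OperatorScaling
namespace OperatorScaling

open Matrix

variable {N : ℕ}

/-! ### Doubly stochastic operators -/

theorem re_trace_sq_conjDiag {U : Mat N} (hU : Uᴴ * U = 1) (d : Fin N → ℝ) :
    ((conjDiag U d ^ 2).trace).re = ∑ i, d i ^ 2 := by
  rw [sq, conjDiag_mul hU, trace_conjDiag hU, Complex.ofReal_re]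
  exact Finset.sum_congr rfl fun i _ => (sq _).symm

theorem re_trace_sq {X : Mat N} (hX : X.IsHermitian) :
    ((X ^ 2).trace).re = ∑ i, ∑ j, ‖X i j‖ ^ 2 := by
  rw [sq, trace, Complex.re_sum]
  refine Finset.sum_congr rfl fun i _ => ?_
  rw [diag_apply, mul_apply, Complex.re_sum]
  refine Finset.sum_congr rfl fun j _ => ?_
  rw [← hX.apply j i, RCLike.star_def, Complex.mul_conj, Complex.ofReal_re,
    Complex.normSq_eq_norm_sq]

theorem re_trace_sq_nonneg {X : Mat N} (hX : X.IsHermitian) : 0 ≤ ((X ^ 2).trace).re := by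
  rw [re_trace_sq hX]
  positivity

theorem eq_zero_of_re_trace_sq {X : Mat N} (hX : X.IsHermitian) (h : ((X ^ 2).trace).re ≤ 0) :
    X = 0 := by
  rw [re_trace_sq hX] at h
  have h0 := le_antisymm h (by positivity)
  ext i j
  have h1 := (Finset.sum_eq_zero_iff_of_nonneg fun i _ => by positivity).mp h0 i (Finset.mem_univ i)
  have h2 := (Finset.sum_eq_zero_iff_of_nonneg fun j _ => by positivity).mp h1 j (Finset.mem_univ j)
  simpa using h2

theorem log_det_conjDiag {U : Mat N} (hU : Uᴴ * U = 1) {d : Fin N → ℝ} (hd : ∀ i, 0 < d i) :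
    Real.log (conjDiag U d).det.re = ∑ i, Real.log (d i) := by
  rw [det_conjDiag hU, Complex.ofReal_re, Real.log_prod fun i _ => (hd i).ne']

theorem re_det_pos {X : Mat N} (hX : X.PosDef) : 0 < X.det.re := (Complex.lt_def.mp hX.det_pos).1

theorem re_det_nonneg {X : Mat N} (hX : X.PosSemidef) : 0 ≤ X.det.re :=
  (Complex.le_def.mp hX.det_nonneg).1

theorem ofReal_re_det {X : Mat N} (hX : X.IsHermitian) : (X.det.re : ℂ) = X.det := by
  obtain ⟨U, d, hU, rfl⟩ := exists_conjDiag hX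
  rw [det_conjDiag hU, Complex.ofReal_re]

theorem re_det_smul (c : ℝ) (X : Mat N) : ((c : ℂ) • X).det.re = c ^ N * X.det.re := by
  rw [det_smul, Fintype.card_fin, ← Complex.ofReal_pow, Complex.re_ofReal_mul]

namespace IsDoublyStochastic

variable {T : Op N} (h : IsDoublyStochastic T) (hT : IsPositive T)
include h hT

theorem posDef_map {X : Mat N} (hX : X.PosDef) : (T X).PosDef :=
  hT.posDef_map (by rw [h.1]; exact PosDef.one) hX

theorem det_le_det_map {X : Mat N} (hX : X.PosDef) : X.det.re ≤ (T X).det.re := by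
  have hTX := h.posDef_map hT hX
  rw [← Real.log_le_log_iff (re_det_pos hX) (re_det_pos hTX)]
  obtain ⟨U, d, hU, rfl⟩ := exists_conjDiag hX.isHermitian
  obtain ⟨V, e, hV, he⟩ := exists_conjDiag hTX.isHermitian
  have hd := (posDef_conjDiag_iff hU).mp hX
  rw [he] at hTX ⊢
  rw [log_det_conjDiag hU hd, log_det_conjDiag hV ((posDef_conjDiag_iff hV).mp hTX),
    ← vecMul_transition_eq hV he]
  exact (sum_log_le_sum_log (h.transition_mem hT hU hV) hd).1

theorem eq_smul_one_of_det_eq (hind : IsIndecomposable T) {X : Mat N} (hX : X.PosDef)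
    (heq : (T X).det.re = X.det.re) : ∃ s : ℝ, X = (s : ℂ) • 1 := by
  have hTX := h.posDef_map hT hX
  obtain ⟨U, d, hU, rfl⟩ := exists_conjDiag hX.isHermitian
  obtain ⟨V, e, hV, he⟩ := exists_conjDiag hTX.isHermitian
  have hd := (posDef_conjDiag_iff hU).mp hX
  have hA := h.transition_mem hT hU hV
  have hlog := congrArg Real.log heq
  rw [he] at hTX hlog
  rw [log_det_conjDiag hU hd, log_det_conjDiag hV ((posDef_conjDiag_iff hV).mp hTX),
    ← vecMul_transition_eq hV he] at hlog
  have hvar := (sum_log_le_sum_log hA hd).2 hlog.symm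
  have hconst := const_of_variance_eq_zero hA hvar (hind.card_lt hT hU hV)
  rcases isEmpty_or_nonempty (Fin N) with hN | ⟨⟨k⟩⟩
  · exact ⟨0, Subsingleton.elim _ _⟩
  · refine ⟨d k, ?_⟩
    rw [← conjDiag_const hU]
    congr 1
    ext i
    exact hconst i k

/-- A decomposable doubly stochastic operator maps some nontrivial projection to a projection of
the same rank. -/
theorem exists_projection (hind : ¬ IsIndecomposable T) :
    ∃ (U V : Mat N) (S R : Finset (Fin N)), Uᴴ * U = 1 ∧ Vᴴ * V = 1 ∧ S.Nonempty ∧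
      S ≠ Finset.univ ∧ R.card = S.card ∧
      T (conjDiag U (indicator S)) = conjDiag V (indicator R) := by
  rw [IsIndecomposable] at hind
  push Not at hind
  obtain ⟨X, hX, hr1, hrN, hrank⟩ := hind
  obtain ⟨U, d, hU, rfl⟩ := exists_conjDiag hX.isHermitian
  have hd := (posSemidef_conjDiag_iff hU).mp hX
  rw [rank_conjDiag hU] at hr1 hrN hrank
  set S := Finset.univ.filter fun i => d i ≠ 0 with hS
  have hP := posSemidef_conjDiag_indicator U S
  obtain ⟨V, e, hV, he⟩ := exists_conjDiag (hT _ hP).isHermitian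
  set R := Finset.univ.filter fun i => e i ≠ 0 with hR
  have hrle : R.card ≤ S.card := by
    rw [hR, ← rank_conjDiag hV, ← he]
    refine le_trans (rank_le_of_ker_le fun v hv => ?_) hrank
    -- This `c` dominates every `1 / d i` on the support, so `c X` dominates the support projection
    -- of `X`. Replacing `X` by that projection therefore does not increase the rank of the image.
    set c : ℝ := ∑ i, (d i)⁻¹ with hc
    have hle : ((c : ℂ) • conjDiag U d - conjDiag U (indicator S)).PosSemidef := by
      rw [conjDiag_smul, conjDiag_sub]
      refine posSemidef_conjDiag fun i => ?_
      by_cases hi : d i = 0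
      · simp [hS, indicator, hi]
      · have hi' : i ∈ S := by simp [hS, hi]
        have h1 : (d i)⁻¹ ≤ c :=
          Finset.single_le_sum (f := fun i => (d i)⁻¹) (fun i _ => inv_nonneg.mpr (hd i))
            (Finset.mem_univ i)
        have h2 := mul_le_mul_of_nonneg_right h1 (hd i)
        rw [inv_mul_cancel₀ hi] at h2
        rw [indicator, if_pos hi']
        linarith
    refine mulVec_eq_zero_of_posSemidef_sub (hT _ hP) (hT.map_le hle) ?_
    rw [map_smul, smul_mulVec, hv, smul_zero]
  have he0 : ∀ i, 0 ≤ e i := by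
    rw [← posSemidef_conjDiag_iff hV, ← he]
    exact hT _ hP
  have he1 : ∀ i, e i ≤ 1 := by
    rw [← conjDiag_bound_iff' hV, ← he, Complex.ofReal_one, one_smul]
    nth_rw 1 [← h.1]
    apply hT.map_le
    have := (conjDiag_bound_iff' (d := indicator S) hU 1).mpr fun i => by
      rw [indicator]; split_ifs <;> norm_num
    simpa using this
  -- Trace preservation: at most `|S|` nonzero eigenvalues, each at most `1`, add up to `|S|`, so
  -- all of them equal `1`.
  have hsum : ∑ i ∈ R, e i = S.card := by
    have h1 : ∑ i ∈ R, e i = ∑ i, e i := by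
      refine Finset.sum_subset (Finset.subset_univ _) fun i _ hi => ?_
      simpa [hR] using hi
    have h2 := hT.trace_map (conjDiag U (indicator S))
    rw [h.2, Matrix.mul_one, he, trace_conjDiag hV, trace_conjDiag hU] at h2
    rw [h1, Complex.ofReal_injective h2]
    simp [indicator]
  have hsub : ∑ i ∈ R, (1 - e i) = (R.card : ℝ) - S.card := by
    rw [Finset.sum_sub_distrib, hsum]
    simp
  have hnn : ∀ i ∈ R, 0 ≤ 1 - e i := fun i _ => sub_nonneg.mpr (he1 i)
  have hcast : (R.card : ℝ) ≤ S.card := by exact_mod_cast hrle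
  have hz : ∑ i ∈ R, (1 - e i) = 0 :=
    le_antisymm (by rw [hsub]; linarith) (Finset.sum_nonneg hnn)
  refine ⟨U, V, S, R, hU, hV, Finset.card_pos.mp hr1, ?_, ?_, ?_⟩
  · rintro hu
    rw [hu] at hrN
    simp at hrN
  · rw [hz] at hsub
    exact_mod_cast (sub_eq_zero.mp hsub.symm)
  · rw [he]
    congr 1
    ext i
    by_cases hi : i ∈ R
    · have := (Finset.sum_eq_zero_iff_of_nonneg hnn).mp hz i hi
      rw [indicator, if_pos hi]
      linarith
    · rw [indicator, if_neg hi]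
      simpa [hR] using hi

omit hT in
theorem map_conjDiag_of_indicator {U V : Mat N} (hU : Uᴴ * U = 1) (hV : Vᴴ * V = 1)
    {S R : Finset (Fin N)} (hSR : T (conjDiag U (indicator S)) = conjDiag V (indicator R))
    (a b : ℝ) : T (conjDiag U fun i => a * indicator S i + b)
      = conjDiag V fun i => a * indicator R i + b := by
  rw [← conjDiag_add, ← conjDiag_add, ← conjDiag_smul, ← conjDiag_smul, map_add, map_smul, hSR,
    conjDiag_const hU, conjDiag_const hV, map_smul, h.1]

end IsDoublyStochastic

theorem sum_comp_indicator (S : Finset (Fin N)) (f : ℝ → ℝ) :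
    ∑ i, f (indicator S i) = S.card * f 1 + (N - S.card) * f 0 := by
  have h1 : ∀ i, f (indicator S i) = f 0 + if i ∈ S then f 1 - f 0 else 0 := fun i => by
    rw [indicator]; split_ifs <;> ring
  simp only [h1, Finset.sum_add_distrib, Finset.sum_const, Finset.card_univ, Fintype.card_fin,
    nsmul_eq_mul, Finset.sum_ite_mem, Finset.univ_inter]
  ring

theorem isCompact_entries_le (r : ℝ) : IsCompact {X : Mat N | ∀ i j, ‖X i j‖ ≤ r} := by
  have h : IsCompact (Set.univ.pi fun _ : Fin N => Set.univ.pi fun _ : Fin N =>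
      Metric.closedBall (0 : ℂ) r) :=
    isCompact_univ_pi fun _ => isCompact_univ_pi fun _ => isCompact_closedBall 0 r
  have e : {X : Fin N → Fin N → ℂ | ∀ i j, ‖X i j‖ ≤ r} = Set.univ.pi fun _ : Fin N =>
      Set.univ.pi fun _ : Fin N => Metric.closedBall (0 : ℂ) r := by
    ext X
    simp [Set.mem_pi]
  rw [← e] at h
  exact h

theorem continuous_op (T : Op N) : Continuous T := LinearMap.continuous_of_finiteDimensional T

/-! ### The contraction gap on traceless Hermitian matrices -/

theorem trace_sq_map_le {T : Op N} (h : IsDoublyStochastic T) (hT : IsPositive T) {X : Mat N}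
    (hX : X.IsHermitian) : ((T X ^ 2).trace).re ≤ ((X ^ 2).trace).re := by
  obtain ⟨V, e, hV, he⟩ := exists_conjDiag (hT.isHermitian_map hX)
  obtain ⟨U, d, hU, rfl⟩ := exists_conjDiag hX
  rw [he, re_trace_sq_conjDiag hU, re_trace_sq_conjDiag hV, ← vecMul_transition_eq hV he]
  have hA := h.transition_mem hT hU hV
  have := sum_sq_sub_sum_sq hA d
  have := variance_nonneg hA d
  linarith

theorem trace_sq_map_lt {T : Op N} (h : IsDoublyStochastic T) (hT : IsPositive T)
    (hind : IsIndecomposable T) {X : Mat N} (hX : X.IsHermitian) (htr : X.trace = 0)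
    (h0 : 0 < ((X ^ 2).trace).re) : ((T X ^ 2).trace).re < ((X ^ 2).trace).re := by
  refine lt_of_le_of_ne (trace_sq_map_le h hT hX) fun heq => ?_
  obtain ⟨V, e, hV, he⟩ := exists_conjDiag (hT.isHermitian_map hX)
  obtain ⟨U, d, hU, rfl⟩ := exists_conjDiag hX
  rw [he, re_trace_sq_conjDiag hU, re_trace_sq_conjDiag hV, ← vecMul_transition_eq hV he] at heq
  have hA := h.transition_mem hT hU hV
  have hvar : variance (transition T U V) d = 0 := by
    rw [← sum_sq_sub_sum_sq hA d, heq, sub_self]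
  have hconst := const_of_variance_eq_zero hA hvar (hind.card_lt hT hU hV)
  have hd : ∀ i, d i = 0 := by
    intro k
    rw [trace_conjDiag hU] at htr
    have h1 : ∑ i, d i = 0 := by exact_mod_cast htr
    simp only [hconst _ k, Finset.sum_const, Finset.card_univ, Fintype.card_fin,
      nsmul_eq_mul] at h1
    have : (N : ℝ) ≠ 0 := by
      have := k.pos
      positivity
    simpa [this] using h1
  rw [re_trace_sq_conjDiag hU] at h0
  simp [hd] at h0

/-- The strict contraction `trace_sq_map_lt` becomes uniform on the compact unit sphere of traceless
Hermitian matrices, and scales to all of them. -/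
theorem exists_gap {T : Op N} (h : IsDoublyStochastic T) (hT : IsPositive T)
    (hind : IsIndecomposable T) :
    ∃ a : ℝ, 0 ≤ a ∧ a < 1 ∧ ∀ X : Mat N, X.IsHermitian → X.trace = 0 →
      (((T X) ^ 2).trace).re ≤ a * ((X ^ 2).trace).re := by
  have hcsq : Continuous fun X : Mat N => ((X ^ 2).trace).re := by fun_prop
  have hcT : Continuous fun X : Mat N => (((T X) ^ 2).trace).re := hcsq.comp (continuous_op T)
  set K : Set (Mat N) := {X | X.IsHermitian ∧ X.trace = 0 ∧ ((X ^ 2).trace).re = 1} with hK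
  have hKc : IsCompact K := by
    refine (isCompact_entries_le (N := N) 1).of_isClosed_subset ?_ ?_
    · refine IsClosed.inter ?_ (IsClosed.inter ?_ ?_)
      · exact isClosed_eq (by fun_prop) continuous_id
      · exact isClosed_eq (by fun_prop) continuous_const
      · exact isClosed_eq hcsq continuous_const
    · rintro X ⟨hX, -, h1⟩ i j
      rw [re_trace_sq hX] at h1
      have h2 : ‖X i j‖ ^ 2 ≤ 1 := by
        rw [← h1]
        refine le_trans ?_ (Finset.single_le_sum (f := fun i => ∑ j, ‖X i j‖ ^ 2)
          (fun i _ => by positivity) (Finset.mem_univ i))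
        exact Finset.single_le_sum (f := fun j => ‖X i j‖ ^ 2)
          (fun i _ => by positivity) (Finset.mem_univ j)
      nlinarith [norm_nonneg (X i j)]
  obtain ⟨a, ha0, ha1, ha⟩ : ∃ a : ℝ, 0 ≤ a ∧ a < 1 ∧ ∀ X ∈ K, (((T X) ^ 2).trace).re ≤ a := by
    rcases K.eq_empty_or_nonempty with hKe | hKn
    -- The sphere is empty when `N ≤ 1`, and any `a` works.
    · exact ⟨0, le_rfl, one_pos, by simp [hKe]⟩
    · obtain ⟨X, hX, hmax⟩ := hKc.exists_isMaxOn hKn hcT.continuousOn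
      refine ⟨_, re_trace_sq_nonneg (hT.isHermitian_map hX.1), ?_, hmax⟩
      have := trace_sq_map_lt h hT hind hX.1 hX.2.1 (by rw [hX.2.2]; exact one_pos)
      rwa [hX.2.2] at this
  refine ⟨a, ha0, ha1, fun X hX htr => ?_⟩
  rcases (re_trace_sq_nonneg hX).eq_or_lt with h0 | h0
  · rw [eq_zero_of_re_trace_sq hX h0.symm.le]
    simp
  · set s := ((X ^ 2).trace).re with hs
    have hsc : ∀ (c : ℝ) (Y : Mat N), ((((c : ℂ) • Y) ^ 2).trace).re
        = c ^ 2 * ((Y ^ 2).trace).re := fun c Y => by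
      rw [smul_pow, trace_smul, smul_eq_mul, ← Complex.ofReal_pow, Complex.re_ofReal_mul]
    have hs2 : ((√s)⁻¹) ^ 2 = s⁻¹ := by rw [inv_pow, Real.sq_sqrt h0.le]
    have hmem : (((√s)⁻¹ : ℝ) : ℂ) • X ∈ K := by
      refine ⟨?_, ?_, ?_⟩
      · rw [IsHermitian, conjTranspose_smul, hX.eq, RCLike.star_def, Complex.conj_ofReal]
      · rw [trace_smul, htr, smul_zero]
      · rw [hsc, hs2]
        exact inv_mul_cancel₀ h0.ne'
    have := ha _ hmem
    rw [map_smul, hsc, hs2, inv_mul_le_iff₀ h0] at this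
    linarith

theorem indecomposable_iff_gap {T : Op N} (h : IsDoublyStochastic T) (hT : IsPositive T) :
    IsIndecomposable T ↔ ∃ a : ℝ, 0 ≤ a ∧ a < 1 ∧ ∀ X : Mat N, X.IsHermitian → X.trace = 0 →
      (((T X) ^ 2).trace).re ≤ a * ((X ^ 2).trace).re := by
  refine ⟨exists_gap h hT, fun ⟨a, _, ha1, hgap⟩ => ?_⟩
  by_contra hind
  obtain ⟨U, V, S, R, hU, hV, hS, hSu, hcard, hSR⟩ := h.exists_projection hT hind
  have hlt : (S.card : ℝ) < N := by exact_mod_cast card_lt_of_ne_univ hSu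
  have hpos : (0 : ℝ) < S.card := by exact_mod_cast hS.card_pos
  have hN : (0 : ℝ) < N := hpos.trans hlt
  -- This shift makes the projection traceless. Its image is the same shift of a projection of equal
  -- rank, so no trace of squares is lost.
  set c : ℝ := -(S.card / N) with hc
  have hmap := h.map_conjDiag_of_indicator hU hV hSR 1 c
  have h1 := hgap (conjDiag U fun i => 1 * indicator S i + c) isHermitian_conjDiag (by
    rw [trace_conjDiag hU, sum_comp_indicator S fun x => 1 * x + c, hc, ← Complex.ofReal_zero]
    congr 1
    field_simp
    ring)
  rw [hmap, re_trace_sq_conjDiag hU, re_trace_sq_conjDiag hV,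
    sum_comp_indicator R fun x => (1 * x + c) ^ 2, sum_comp_indicator S fun x => (1 * x + c) ^ 2,
    hcard] at h1
  have h2 : 0 < (S.card : ℝ) * (1 * 1 + c) ^ 2 + (N - S.card) * (1 * 0 + c) ^ 2 := by
    have : c < 0 := by rw [hc]; exact neg_neg_of_pos (div_pos hpos hN)
    have := mul_pos (sub_pos.mpr hlt) (pow_pos (neg_pos.mpr this) 2)
    nlinarith [mul_nonneg hpos.le (sq_nonneg (1 * 1 + c))]
  nlinarith

end OperatorScaling
namespace OperatorScaling

open Matrix

variable {N : ℕ}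

/-! ### Minimizers of the normalized determinant -/

/-- `C` minimizes `det T(X) / det X` over the positive definite matrices. -/
def Optimal (T : Op N) (C : Mat N) : Prop :=
  C.PosDef ∧ ∀ X : Mat N, X.PosDef → (T C).det.re * X.det.re ≤ (T X).det.re * C.det.re

theorem posDef_smul {c : ℝ} (hc : 0 < c) {X : Mat N} (hX : X.PosDef) : ((c : ℂ) • X).PosDef :=
  hX.smul (by exact_mod_cast hc)

theorem Optimal.smul {T : Op N} {C : Mat N} (h : Optimal T C) {c : ℝ} (hc : 0 < c) :
    Optimal T ((c : ℂ) • C) := by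
  refine ⟨posDef_smul hc h.1, fun X hX => ?_⟩
  rw [map_smul, re_det_smul, re_det_smul]
  have := mul_le_mul_of_nonneg_left (h.2 X hX) (pow_pos hc N).le
  linarith

theorem exists_smul_det_eq_one {X : Mat N} (hX : X.PosDef) :
    ∃ c : ℝ, 0 < c ∧ ((c : ℂ) • X).det = 1 := by
  have hd := re_det_pos hX
  obtain ⟨c, hc, h⟩ : ∃ c : ℝ, 0 < c ∧ c ^ N * X.det.re = 1 := by
    rcases Nat.eq_zero_or_pos N with rfl | hN
    · exact ⟨1, one_pos, by simp⟩
    · refine ⟨(X.det.re) ^ (-(N : ℝ)⁻¹), Real.rpow_pos_of_pos hd _, ?_⟩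
      have hN' : (N : ℝ) ≠ 0 := by positivity
      rw [← Real.rpow_natCast, ← Real.rpow_mul hd.le, neg_mul, inv_mul_cancel₀ hN',
        Real.rpow_neg_one, inv_mul_cancel₀ hd.ne']
  refine ⟨c, hc, ?_⟩
  rw [← ofReal_re_det (posDef_smul hc hX).isHermitian, re_det_smul, h, Complex.ofReal_one]

theorem capacity_le {T : Op N} (hT : IsPositive T) {X : Mat N} (hX : X.PosDef) (h1 : X.det = 1) :
    capacity T ≤ (T X).det.re := by
  refine csInf_le ⟨0, ?_⟩ ⟨X, hX, h1, rfl⟩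
  rintro _ ⟨Y, hY, -, rfl⟩
  exact re_det_nonneg (hT _ hY.posSemidef)

/-- `det T(X)` and `det X` are both homogeneous of degree `N`, so the constraint `det X = 1` is only
a normalization. -/
theorem isMinimizer_iff {T : Op N} (hT : IsPositive T) {C : Mat N} :
    IsMinimizer T C ↔ Optimal T C ∧ C.det = 1 := by
  constructor
  · rintro ⟨hC, h1, hcap⟩
    refine ⟨⟨hC, fun X hX => ?_⟩, h1⟩
    obtain ⟨c, hc, hc1⟩ := exists_smul_det_eq_one hX
    have h2 := capacity_le hT (posDef_smul hc hX) hc1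
    have h3 : c ^ N * X.det.re = 1 := by rw [← re_det_smul, hc1, Complex.one_re]
    rw [map_smul, re_det_smul, hcap] at h2
    rw [h1, Complex.one_re, mul_one]
    calc (T C).det.re * X.det.re ≤ c ^ N * (T X).det.re * X.det.re :=
          mul_le_mul_of_nonneg_right h2 (re_det_pos hX).le
      _ = (T X).det.re := by rw [mul_right_comm, h3, one_mul]
  · rintro ⟨hC, h1⟩
    refine ⟨hC.1, h1, IsLeast.csInf_eq ⟨⟨C, hC.1, h1, rfl⟩, ?_⟩⟩
    rintro _ ⟨X, hX, hX1, rfl⟩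
    have := hC.2 X hX
    rwa [h1, hX1, Complex.one_re, mul_one, mul_one] at this

theorem capacity_nonneg {T : Op N} (hT : IsPositive T) : 0 ≤ capacity T := by
  apply Real.sInf_nonneg
  rintro _ ⟨Y, hY, -, rfl⟩
  exact re_det_nonneg (hT _ hY.posSemidef)

theorem Optimal.exists_minimizer {T : Op N} (hT : IsPositive T) {C : Mat N} (h : Optimal T C) :
    ∃ c : ℝ, 0 < c ∧ IsMinimizer T ((c : ℂ) • C) := by
  obtain ⟨c, hc, h1⟩ := exists_smul_det_eq_one h.1
  exact ⟨c, hc, (isMinimizer_iff hT).mpr ⟨h.smul hc, h1⟩⟩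

/-! ### The critical point equation -/

/-- Factoring out `A` leaves `det(1 + t A⁻¹B)`, a polynomial in `t` with linear coefficient
`tr(A⁻¹B)`; `q` gathers the terms from degree two on. This serves as the derivative of the
determinant. -/
theorem re_det_add_smul {A B : Mat N} (hA : A.PosDef) :
    ∃ q : Polynomial ℂ, ∀ t : ℝ, (A + (t : ℂ) • B).det.re
      = A.det.re * (1 + t * ((A⁻¹ * B).trace).re + t ^ 2 * (q.eval (t : ℂ)).re) := by
  refine ⟨(det (1 + (Polynomial.X : Polynomial ℂ) • (A⁻¹ * B).map Polynomial.C)).divX.divX,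
    fun t => ?_⟩
  have h1 : A + (t : ℂ) • B = A * (1 + (t : ℂ) • (A⁻¹ * B)) := by
    rw [Matrix.mul_add, Matrix.mul_one, Matrix.mul_smul, ← Matrix.mul_assoc,
      mul_nonsing_inv _ ((isUnit_iff_isUnit_det _).mp hA.isUnit), Matrix.one_mul]
  rw [h1, det_mul, det_one_add_smul, ← ofReal_re_det hA.isHermitian, Complex.re_ofReal_mul,
    Complex.ofReal_re]
  congr 1
  rw [← Complex.ofReal_pow, Complex.add_re, Complex.add_re, Complex.one_re,
    Complex.re_mul_ofReal, Complex.re_mul_ofReal]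
  ring

theorem nonneg_of_eventually_quadratic {a : ℝ} {g : ℝ → ℝ} (hg : Continuous g)
    (h : ∀ t : ℝ, 0 < t → 0 ≤ t * a + t ^ 2 * g t) : 0 ≤ a := by
  have hlim : Filter.Tendsto (fun t => a + t * g t) (nhdsWithin 0 (Set.Ioi 0)) (nhds a) := by
    have hc : Continuous fun t => a + t * g t := by fun_prop
    have := hc.tendsto 0
    simp only [zero_mul, add_zero] at this
    exact this.mono_left nhdsWithin_le_nhds
  refine ge_of_tendsto hlim ?_
  filter_upwards [self_mem_nhdsWithin] with t ht
  have ht' : 0 < t := ht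
  have h1 := h t ht'
  have h2 : t * a + t ^ 2 * g t = t * (a + t * g t) := by ring
  rw [h2] at h1
  exact nonneg_of_mul_nonneg_right h1 ht'

/-- The one-sided derivative of `det T(X) / det X` at `C` along `Z` is nonnegative; `Z ⪰ 0` keeps `C
+ tZ` positive definite for every `t > 0`. -/
theorem Optimal.trace_le {T : Op N} {C : Mat N} (h : Optimal T C)
    (hTC : (T C).PosDef) {Z : Mat N} (hZ : Z.PosSemidef) :
    ((C⁻¹ * Z).trace).re ≤ (((T C)⁻¹ * T Z).trace).re := by
  obtain ⟨p, hp⟩ := re_det_add_smul (B := Z) h.1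
  obtain ⟨q, hq⟩ := re_det_add_smul (B := T Z) hTC
  rw [← sub_nonneg]
  refine nonneg_of_eventually_quadratic
    (g := fun t => (q.eval (t : ℂ)).re - (p.eval (t : ℂ)).re) (by fun_prop) fun t ht => ?_
  have h1 := h.2 (C + (t : ℂ) • Z)
    (h.1.add_posSemidef (hZ.smul (by exact_mod_cast ht.le)))
  rw [map_add, map_smul, hp, hq] at h1
  have hpos := mul_pos (re_det_pos hTC) (re_det_pos h.1)
  have h2 : 0 ≤ ((T C).det.re * C.det.re) *
      (t * ((((T C)⁻¹ * T Z).trace).re - ((C⁻¹ * Z).trace).re)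
        + t ^ 2 * ((q.eval (t : ℂ)).re - (p.eval (t : ℂ)).re)) := by linarith
  exact nonneg_of_mul_nonneg_right h2 hpos

/-- The difference of the two sides pairs nonnegatively with every `Z ⪰ 0`, so it is positive
semidefinite. Its pairing with `C` is `N - N = 0`, and `C ≻ 0` forces it to vanish. -/
theorem Optimal.dual_inv {T : Op N} (hT : IsPositive T) {C : Mat N} (h : Optimal T C)
    (hTC : (T C).PosDef) : dual T ((T C)⁻¹) = C⁻¹ := by
  have key : ∀ Z : Mat N, ((((dual T ((T C)⁻¹)) - C⁻¹) * Z).trace).re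
      = (((T C)⁻¹ * T Z).trace).re - ((C⁻¹ * Z).trace).re := fun Z => by
    rw [Matrix.sub_mul, trace_sub, Complex.sub_re, Matrix.trace_mul_comm, ← hT.trace_map_mul,
      Matrix.trace_mul_comm (T Z)]
  have hle : ∀ Z : Mat N, Z.PosSemidef → 0 ≤ ((((dual T ((T C)⁻¹)) - C⁻¹) * Z).trace).re :=
    fun Z hZ => by
      rw [key, sub_nonneg]
      exact h.trace_le hTC hZ
  have hC0 : ((((dual T ((T C)⁻¹)) - C⁻¹) * C).trace).re = 0 := by
    rw [key, nonsing_inv_mul _ ((isUnit_iff_isUnit_det _).mp hTC.isUnit),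
      nonsing_inv_mul _ ((isUnit_iff_isUnit_det _).mp h.1.isUnit), sub_self]
  have hWherm : ((dual T ((T C)⁻¹)) - C⁻¹).IsHermitian :=
    (hT.dual.isHermitian_map hTC.inv.isHermitian).sub h.1.inv.isHermitian
  obtain ⟨m, hm, hmC⟩ := exists_posDef_bound h.1
  obtain ⟨U, w, hU, hw⟩ := exists_conjDiag hWherm
  rw [hw] at hle hC0
  have hsum : ∀ d : Fin N → ℝ, ((conjDiag U w * conjDiag U d).trace).re = ∑ i, w i * d i :=
    fun d => by rw [conjDiag_mul hU, trace_conjDiag hU, Complex.ofReal_re]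
  have hw0 : ∀ i, 0 ≤ w i := fun i => by
    have := hle (conjDiag U (indicator {i})) (posSemidef_conjDiag_indicator U {i})
    rw [hsum] at this
    simpa [indicator] using this
  -- Pairing with `C - m·1 ⪰ 0` gives `-m ∑ w ≥ 0`.
  have hz : ∑ i, w i ≤ 0 := by
    have h1 := hle _ hmC
    rw [Matrix.mul_sub, trace_sub, Complex.sub_re, hC0, Matrix.mul_smul, Matrix.mul_one,
      trace_smul, trace_conjDiag hU, smul_eq_mul, ← Complex.ofReal_mul, Complex.ofReal_re] at h1
    by_contra hcon
    push Not at hcon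
    have := mul_pos hm hcon
    linarith
  rw [← sub_eq_zero, hw]
  have hw1 : ∀ i, w i = 0 := fun i =>
    (Finset.sum_eq_zero_iff_of_nonneg fun i _ => hw0 i).mp
      (le_antisymm hz (Finset.sum_nonneg fun i _ => hw0 i)) i (Finset.mem_univ i)
  have : w = fun _ => 0 := funext hw1
  rw [this, conjDiag_const hU, Complex.ofReal_zero, zero_smul]

/-- The condition at `I` holds by the choice of factors; the dual condition is the critical point
equation conjugated by `C^{1/2}`. -/
theorem Optimal.scaling_isDoublyStochastic {T : Op N} (hT : IsPositive T) {C : Mat N}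
    (h : Optimal T C) (hTC : (T C).PosDef) :
    IsDoublyStochastic (scaling (power (T C) (-1 / 2)) (power C (1 / 2)) T) := by
  constructor
  · rw [scaling_apply, Matrix.mul_one, (isHermitian_power C _).eq, power_half_mul_self h.1,
      (isHermitian_power (T C) _).eq, power_neg_half_mul_mul hTC]
  · rw [hT.dual_scaling_apply, Matrix.mul_one, (isHermitian_power (T C) _).eq,
      power_neg_half_mul_self hTC, h.dual_inv hT hTC, (isHermitian_power C _).eq]
    have hu : IsUnit (power C (1 / 2)).det := isUnit_det_power h.1 _
    nth_rw 2 [← power_half_mul_self h.1]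
    rw [Matrix.mul_inv_rev, ← Matrix.mul_assoc, mul_nonsing_inv _ hu, Matrix.one_mul,
      nonsing_inv_mul _ hu]

theorem posDef_of_capacity_pos {T : Op N} (hT : IsPositive T) (hcap : 0 < capacity T) {C : Mat N}
    (h : IsMinimizer T C) : (T C).PosDef := by
  rw [(hT _ h.1.posSemidef).posDef_iff_det_ne_zero]
  intro h0
  rw [h.2.2, h0] at hcap
  exact lt_irrefl _ hcap

theorem IsDoublyStochastic.optimal_of_det_eq {T : Op N} (h : IsDoublyStochastic T)
    (hT : IsPositive T) {Z : Mat N} (hZ : Z.PosDef) (heq : (T Z).det.re = Z.det.re) :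
    Optimal T Z := by
  refine ⟨hZ, fun X hX => ?_⟩
  rw [heq, mul_comm]
  exact mul_le_mul_of_nonneg_right (h.det_le_det_map hT hX) (re_det_pos hZ).le

theorem posDef_conjTranspose_mul_mul {B X : Mat N} (hB : IsUnit B.det) (hX : X.PosDef) :
    (Bᴴ * X * B).PosDef := by
  have h1 : IsUnit B := (isUnit_iff_isUnit_det _).mpr hB
  rw [← star_eq_conjTranspose, IsUnit.posDef_star_left_conjugate_iff h1]
  exact hX

theorem posDef_mul_mul_conjTranspose {B X : Mat N} (hB : IsUnit B.det) (hX : X.PosDef) :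
    (B * X * Bᴴ).PosDef := by
  have h1 : IsUnit B := (isUnit_iff_isUnit_det _).mpr hB
  rw [← star_eq_conjTranspose, IsUnit.posDef_star_right_conjugate_iff h1]
  exact hX

theorem re_det_conjTranspose_mul_mul (B X : Mat N) :
    (Bᴴ * X * B).det.re = Complex.normSq B.det * X.det.re := by
  rw [det_mul, det_mul, det_conjTranspose, mul_right_comm, RCLike.star_def,
    ← Complex.normSq_eq_conj_mul_self, Complex.re_ofReal_mul]

theorem re_det_mul_mul_conjTranspose (B X : Mat N) :
    (B * X * Bᴴ).det.re = Complex.normSq B.det * X.det.re := by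
  have := re_det_conjTranspose_mul_mul Bᴴ X
  rwa [conjTranspose_conjTranspose, det_conjTranspose, RCLike.star_def,
    Complex.normSq_conj] at this

/-- A minimizer of a scaling of `T` yields one of `T`. -/
theorem Optimal.of_scaling {T : Op N} {C₁ C₂ Z : Mat N} (h₁ : IsUnit C₁.det) (h₂ : IsUnit C₂.det)
    (h : Optimal (scaling C₁ C₂ T) Z) : Optimal T (C₂ᴴ * Z * C₂) := by
  refine ⟨posDef_conjTranspose_mul_mul h₂ h.1, fun X hX => ?_⟩
  have h₂' : IsUnit C₂ᴴ.det := by rw [det_conjTranspose]; exact h₂.star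
  have hi := isUnit_nonsing_inv_det _ h₂
  have e : C₂ᴴ * (C₂⁻¹ᴴ * X * C₂⁻¹) * C₂ = X := by
    rw [conjTranspose_nonsing_inv, Matrix.mul_assoc (C₂ᴴ⁻¹), ← Matrix.mul_assoc,
      mul_nonsing_inv _ h₂', Matrix.one_mul, Matrix.mul_assoc, nonsing_inv_mul _ h₂, Matrix.mul_one]
  have h1 := h.2 _ (posDef_conjTranspose_mul_mul hi hX)
  rw [scaling_apply, scaling_apply, e, re_det_mul_mul_conjTranspose,
    re_det_mul_mul_conjTranspose] at h1
  have hX' : X.det.re = Complex.normSq C₂.det * (C₂⁻¹ᴴ * X * C₂⁻¹).det.re := by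
    rw [← re_det_conjTranspose_mul_mul, e]
  have hp₁ : 0 < Complex.normSq C₁.det := Complex.normSq_pos.mpr h₁.ne_zero
  have hp₂ : 0 < Complex.normSq C₂.det := Complex.normSq_pos.mpr h₂.ne_zero
  rw [hX', re_det_conjTranspose_mul_mul C₂ Z]
  have h2 := mul_le_mul_of_nonneg_left h1 hp₂.le
  refine le_of_mul_le_mul_left ?_ hp₁
  linarith

theorem scalable_iff {T : Op N} (hT : IsPositive T) :
    (∃ C₁ C₂ : Mat N, IsUnit C₁.det ∧ IsUnit C₂.det ∧ IsDoublyStochastic (scaling C₁ C₂ T)) ↔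
      (0 < capacity T ∧ ∃ C : Mat N, IsMinimizer T C) := by
  constructor
  · rintro ⟨C₁, C₂, h₁, h₂, hds⟩
    have hopt : Optimal (scaling C₁ C₂ T) 1 :=
      hds.optimal_of_det_eq (hT.scaling C₁ C₂) PosDef.one (by rw [hds.1])
    obtain ⟨c, hc, hmin⟩ := (hopt.of_scaling h₁ h₂).exists_minimizer hT
    refine ⟨lt_of_le_of_ne (capacity_nonneg hT) fun h0 => ?_, _, hmin⟩
    have h1 := hmin.2.2
    have h2 : (C₁ * T (C₂ᴴ * 1 * C₂) * C₁ᴴ).det.re = 1 := by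
      rw [← scaling_apply, hds.1, det_one, Complex.one_re]
    rw [re_det_mul_mul_conjTranspose] at h2
    rw [← h0, map_smul, re_det_smul] at h1
    rcases mul_eq_zero.mp h1.symm with h3 | h3
    · exact (pow_pos hc N).ne' h3
    · rw [h3, mul_zero] at h2
      exact zero_ne_one h2
  · rintro ⟨hcap, C, hC⟩
    have hTC := posDef_of_capacity_pos hT hcap hC
    exact ⟨_, _, isUnit_det_power hTC _, isUnit_det_power hC.1 _,
      ((isMinimizer_iff hT).mp hC).1.scaling_isDoublyStochastic hT hTC⟩

end OperatorScaling
namespace OperatorScaling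

open Matrix Filter Topology

variable {N : ℕ}

/-! ### Existence of minimizers for perturbed operators -/

/-- The perturbation `X ↦ T(X) + ε tr(X) I`. -/
noncomputable def perturb (T : Op N) (ε : ℝ) : Op N :=
  T + (ε : ℂ) • (traceLinearMap (Fin N) ℂ ℂ).smulRight (1 : Mat N)

theorem perturb_apply (T : Op N) (ε : ℝ) (X : Mat N) :
    perturb T ε X = T X + ((ε : ℂ) * X.trace) • 1 := by
  simp [perturb, smul_smul]

theorem perturb_isPositive {T : Op N} (hT : IsPositive T) {ε : ℝ} (hε : 0 ≤ ε) :
    IsPositive (perturb T ε) := fun X hX => by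
  rw [perturb_apply]
  exact (hT X hX).add (PosSemidef.one.smul (mul_nonneg (by exact_mod_cast hε) hX.trace_nonneg))

theorem posDef_perturb {T : Op N} (hT : IsPositive T) {ε : ℝ} (hε : 0 < ε) {X : Mat N}
    (hX : X.PosSemidef) (h1 : X.trace = 1) : (perturb T ε X).PosDef := by
  rw [perturb_apply, h1, mul_one]
  exact (posDef_smul hε PosDef.one).posSemidef_add (hT X hX)

theorem isClosed_posSemidef : IsClosed {X : Mat N | X.PosSemidef} := by
  have e : {X : Mat N | X.PosSemidef} = {X : Mat N | Xᴴ = X} ∩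
      ⋂ v : Fin N → ℂ, {X : Mat N | 0 ≤ star v ⬝ᵥ (X *ᵥ v)} := by
    ext X
    simp only [Set.mem_ofPred_eq, Set.mem_inter_iff, Set.mem_iInter]
    exact posSemidef_iff_dotProduct_mulVec
  rw [e]
  refine (isClosed_eq (by fun_prop) continuous_id).inter (isClosed_iInter fun v => ?_)
  exact isClosed_le continuous_const (by fun_prop)

theorem norm_entry_le_of_trace_eq_one {X : Mat N} (hX : X.PosSemidef) (h1 : X.trace = 1)
    (i j : Fin N) : ‖X i j‖ ≤ 1 := by
  have h2 : ((X ^ 2).trace).re ≤ 1 := by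
    obtain ⟨U, d, hU, rfl⟩ := exists_conjDiag hX.isHermitian
    rw [posSemidef_conjDiag_iff hU] at hX
    rw [trace_conjDiag hU] at h1
    have h3 : ∑ i, d i = 1 := by exact_mod_cast h1
    rw [re_trace_sq_conjDiag hU]
    calc ∑ i, d i ^ 2 ≤ ∑ i, d i := Finset.sum_le_sum fun i _ => by
          have h4 : d i ≤ 1 := h3 ▸ Finset.single_le_sum (fun i _ => hX i) (Finset.mem_univ i)
          nlinarith [hX i]
      _ = 1 := h3
  rw [re_trace_sq hX.isHermitian] at h2
  have h5 : ‖X i j‖ ^ 2 ≤ 1 := by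
    refine le_trans ?_ h2
    refine le_trans ?_ (Finset.single_le_sum (f := fun i => ∑ j, ‖X i j‖ ^ 2)
      (fun i _ => by positivity) (Finset.mem_univ i))
    exact Finset.single_le_sum (f := fun j => ‖X i j‖ ^ 2)
      (fun i _ => by positivity) (Finset.mem_univ j)
  nlinarith [norm_nonneg (X i j)]

theorem re_trace_pos (hN : 0 < N) {X : Mat N} (hX : X.PosDef) : 0 < X.trace.re := by
  have : Nonempty (Fin N) := ⟨⟨0, hN⟩⟩
  exact (Complex.lt_def.mp hX.trace_pos).1

theorem ofReal_re_trace {X : Mat N} (hX : X.IsHermitian) : (X.trace.re : ℂ) = X.trace := by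
  obtain ⟨U, d, hU, rfl⟩ := exists_conjDiag hX
  rw [trace_conjDiag hU, Complex.ofReal_re]

/-- On the compact set of density matrices the perturbed determinant is positive, so `det X / det
P(X)` attains a maximum. The maximizer is nonsingular because the ratio is positive at the
normalized identity, and homogeneity extends its optimality to all `X ≻ 0`. -/
theorem exists_optimal_perturb (hN : 0 < N) {T : Op N} (hT : IsPositive T) {ε : ℝ} (hε : 0 < ε) :
    ∃ C : Mat N, Optimal (perturb T ε) C ∧ C.trace = 1 := by
  set P := perturb T ε with hP
  have hnorm : ∀ X : Mat N, X.PosDef → 0 < (X.trace.re)⁻¹ ∧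
      (((X.trace.re)⁻¹ : ℝ) : ℂ) • X ∈ {X : Mat N | X.PosSemidef ∧ X.trace = 1} := by
    intro X hX
    have h0 := re_trace_pos hN hX
    refine ⟨inv_pos.mpr h0, (posDef_smul (inv_pos.mpr h0) hX).posSemidef, ?_⟩
    rw [trace_smul, ← ofReal_re_trace hX.isHermitian, smul_eq_mul, Complex.ofReal_re,
      ← Complex.ofReal_mul, inv_mul_cancel₀ h0.ne', Complex.ofReal_one]
  have hK : IsCompact {X : Mat N | X.PosSemidef ∧ X.trace = 1} := by
    refine (isCompact_entries_le (N := N) 1).of_isClosed_subset ?_ ?_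
    · exact isClosed_posSemidef.inter (isClosed_eq (by fun_prop) continuous_const)
    · exact fun X hX i j => norm_entry_le_of_trace_eq_one hX.1 hX.2 i j
  have hpos : ∀ X ∈ {X : Mat N | X.PosSemidef ∧ X.trace = 1}, 0 < (P X).det.re :=
    fun X hX => re_det_pos (posDef_perturb hT hε hX.1 hX.2)
  have hdet : Continuous fun X : Mat N => X.det.re := by fun_prop
  obtain ⟨C, hC, hmax⟩ := hK.exists_isMaxOn ⟨_, (hnorm 1 PosDef.one).2⟩
    (f := fun X => X.det.re / (P X).det.re)
    (hdet.continuousOn.div (hdet.comp (continuous_op P)).continuousOn fun X hX => (hpos X hX).ne')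
  have hle : ∀ X ∈ {X : Mat N | X.PosSemidef ∧ X.trace = 1},
      X.det.re * (P C).det.re ≤ C.det.re * (P X).det.re := fun X hX =>
    (div_le_div_iff₀ (hpos X hX) (hpos C hC)).mp (hmax hX)
  refine ⟨C, ⟨?_, fun X hX => ?_⟩, hC.2⟩
  · rw [hC.1.posDef_iff_det_ne_zero]
    intro h0
    have h1 := hnorm 1 PosDef.one
    have h2 := hle _ h1.2
    rw [h0, Complex.zero_re, zero_mul] at h2
    exact absurd h2 (not_le.mpr (mul_pos (re_det_pos (posDef_smul h1.1 PosDef.one)) (hpos C hC)))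
  · have h1 := hnorm X hX
    have h2 := hle _ h1.2
    rw [map_smul, re_det_smul, re_det_smul] at h2
    refine le_of_mul_le_mul_left ?_ (pow_pos h1.1 N)
    linarith

/-! ### Passing to the limit -/

theorem re_trace_mul_conjDiag (M V : Mat N) (f : Fin N → ℝ) :
    (M * conjDiag V f).trace.re = ∑ j, ((Vᴴ * M * V) j j).re * f j := by
  rw [conjDiag, ← Matrix.mul_assoc, Matrix.trace_mul_comm, ← Matrix.mul_assoc,
    ← Matrix.mul_assoc, trace, Complex.re_sum]
  refine Finset.sum_congr rfl fun j _ => ?_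
  rw [diag_apply, mul_diagonal, Complex.re_mul_ofReal]

/-- The weights `d i * t i j / e j`, with `t` the transition matrix, have column sums `1` because `e
= d t`, and row sums `1` by the critical point equation. Unlike the inverses of `d` and `e`, they
stay bounded when `C` degenerates, so they pass to the limit. -/
theorem Optimal.exists_weights {T : Op N} (hT : IsPositive T) {U V : Mat N} {d e : Fin N → ℝ}
    (hU : Uᴴ * U = 1) (hV : Vᴴ * V = 1) (h : Optimal T (conjDiag U d))
    (he : T (conjDiag U d) = conjDiag V e) (he0 : ∀ j, 0 < e j) :
    ∃ A ∈ doublyStochastic ℝ (Fin N), ∀ i j, A i j * e j = d i * transition T U V i j := by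
  refine ⟨Matrix.of fun i j => d i * transition T U V i j / e j, ?_, fun i j =>
    div_mul_cancel₀ _ (he0 j).ne'⟩
  have hd := (posDef_conjDiag_iff hU).mp h.1
  rw [mem_doublyStochastic_iff_sum]
  simp only [of_apply]
  refine ⟨fun i j => ?_, fun i => ?_, fun j => ?_⟩
  · exact div_nonneg (mul_nonneg (hd i).le (transition_nonneg hT U V i j)) (he0 j).le
  · have hTC : (T (conjDiag U d)).PosDef := by rw [he, posDef_conjDiag_iff hV]; exact he0
    have h1 := h.dual_inv hT hTC
    rw [he, inv_conjDiag hV fun j => (he0 j).ne', inv_conjDiag hU fun i => (hd i).ne'] at h1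
    have h2 := hT.trace_map_mul (conjDiag U (Pi.single i 1)) (conjDiag V fun j => (e j)⁻¹)
    rw [h1, conjDiag_mul hU, trace_conjDiag hU] at h2
    have h3 := re_trace_mul_conjDiag (T (conjDiag U (Pi.single i 1))) V fun j => (e j)⁻¹
    rw [h2, Complex.ofReal_re] at h3
    calc ∑ j, d i * transition T U V i j / e j
        = d i * ∑ j, transition T U V i j * (e j)⁻¹ := by
          rw [Finset.mul_sum]
          exact Finset.sum_congr rfl fun j _ => by ring
      _ = d i * ∑ j, (Pi.single i 1 : Fin N → ℝ) j * (d j)⁻¹ := by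
          rw [h3]
          rfl
      _ = 1 := by simp [Pi.single_apply, (hd i).ne']
  · rw [← Finset.sum_div, div_eq_one_iff_eq (he0 j).ne']
    exact congrFun (vecMul_transition_eq hV he) j

/-- A single ultrafilter makes all bounded sequences converge at once, in place of repeated
extraction of subsequences. -/
theorem exists_ultralimit {f : ℕ → ℝ} {a b : ℝ} (h : ∀ k, f k ∈ Set.Icc a b) :
    ∃ x ∈ Set.Icc a b, Tendsto f (hyperfilter ℕ) (𝓝 x) := by
  have := (isCompact_Icc (a := a) (b := b)).ultrafilter_le_nhds ((hyperfilter ℕ).map f)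
    (by
      rw [le_principal_iff]
      exact Filter.mem_map.mpr (Filter.univ_mem' h))
  exact this

theorem exists_ultralimit_matrix {f : ℕ → Mat N} (h : ∀ k, (f k)ᴴ * f k = 1) :
    ∃ X : Mat N, Tendsto f (hyperfilter ℕ) (𝓝 X) := by
  have h1 : ∀ k i j, ‖f k i j‖ ≤ 1 := fun k =>
    entry_norm_bound_of_unitary (mem_unitaryGroup_iff'.mpr (h k))
  obtain ⟨X, -, hX⟩ := (isCompact_entries_le (N := N) 1).ultrafilter_le_nhds
    ((hyperfilter ℕ).map f) (by
      rw [le_principal_iff]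
      exact Filter.mem_map.mpr (Filter.univ_mem' h1))
  exact ⟨X, hX⟩

theorem continuous_conjDiag : Continuous fun p : Mat N × (Fin N → ℝ) => conjDiag p.1 p.2 := by
  unfold conjDiag
  fun_prop

theorem tendsto_perturb {ι : Type*} {l : Filter ι} {ε : ι → ℝ} (hε : Tendsto ε l (𝓝 0)) (T : Op N)
    {X : ι → Mat N} {Y : Mat N} (hX : Tendsto X l (𝓝 Y)) :
    Tendsto (fun k => perturb T (ε k) (X k)) l (𝓝 (T Y)) := by
  have hc : Continuous fun p : ℝ × Mat N => T p.2 + ((p.1 : ℂ) * p.2.trace) • (1 : Mat N) := by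
    have h1 : Continuous fun p : ℝ × Mat N => T p.2 := (continuous_op T).comp continuous_snd
    have h2 : Continuous fun p : ℝ × Mat N => (p.1 : ℂ) :=
      Complex.continuous_ofReal.comp continuous_fst
    have h3 : Continuous fun p : ℝ × Mat N => p.2.trace := by fun_prop
    exact h1.add ((h2.mul h3).smul continuous_const)
  have h := (hc.tendsto ((0 : ℝ), Y)).comp (hε.prodMk_nhds hX)
  simp only [Complex.ofReal_zero, zero_mul, zero_smul, add_zero] at h
  exact h.congr fun k => (perturb_apply T (ε k) (X k)).symm

theorem tendsto_conjDiag {ι : Type*} {l : Filter ι} {W : ι → Mat N} {W' : Mat N}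
    {f : ι → Fin N → ℝ} {f' : Fin N → ℝ} (hW : Tendsto W l (𝓝 W')) (hf : Tendsto f l (𝓝 f')) :
    Tendsto (fun k => conjDiag (W k) (f k)) l (𝓝 (conjDiag W' f')) := by
  have h := (continuous_conjDiag.tendsto (W', f')).comp (hW.prodMk_nhds hf)
  exact h

/-- The limit `ε → 0` of the perturbed minimizers. The limiting `C` may be singular, so optimality
is kept in product form and the critical point equation as the division-free relation between `A`,
`d` and `e`. -/
theorem exists_limit_data (hN : 0 < N) {T : Op N} (hT : IsPositive T) :
    ∃ (U V : Mat N) (d e : Fin N → ℝ) (A : Matrix (Fin N) (Fin N) ℝ), Uᴴ * U = 1 ∧ Vᴴ * V = 1 ∧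
      (∀ i, 0 ≤ d i) ∧ ∑ i, d i = 1 ∧ T (conjDiag U d) = conjDiag V e ∧
      A ∈ doublyStochastic ℝ (Fin N) ∧
      (∀ i j, A i j * e j = d i * transition T U V i j) ∧
      ∀ X : Mat N, X.PosDef →
        (T (conjDiag U d)).det.re * X.det.re ≤ (T X).det.re * (conjDiag U d).det.re := by
  obtain ⟨ε, hε, hε0⟩ : ∃ ε : ℕ → ℝ, (∀ k, 0 < ε k) ∧ Tendsto ε atTop (𝓝 0) :=
    ⟨fun k => 1 / ((k : ℝ) + 1), fun k => by positivity, tendsto_one_div_add_atTop_nhds_zero_nat⟩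
  have hex : ∀ k : ℕ, ∃ (U V : Mat N) (d e : Fin N → ℝ), Uᴴ * U = 1 ∧ Vᴴ * V = 1 ∧
      Optimal (perturb T (ε k)) (conjDiag U d) ∧ (∑ i, d i = 1) ∧
      perturb T (ε k) (conjDiag U d) = conjDiag V e ∧ ∀ j, 0 < e j := by
    intro k
    obtain ⟨C, hC, htr⟩ := exists_optimal_perturb hN hT (hε k)
    have hP := posDef_perturb hT (hε k) hC.1.posSemidef htr
    obtain ⟨U, d, hU, rfl⟩ := exists_conjDiag hC.1.isHermitian
    obtain ⟨V, e, hV, he⟩ := exists_conjDiag hP.isHermitian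
    rw [trace_conjDiag hU] at htr
    refine ⟨U, V, d, e, hU, hV, hC, by exact_mod_cast htr, he, ?_⟩
    rwa [he, posDef_conjDiag_iff hV] at hP
  choose U V d e hU hV hopt hsum he he0 using hex
  have hd : ∀ k i, 0 < d k i := fun k => (posDef_conjDiag_iff (hU k)).mp (hopt k).1
  choose A hA hAe using fun k => (hopt k).exists_weights (perturb_isPositive hT (hε k).le) (hU k)
    (hV k) (he k) (he0 k)
  obtain ⟨U', hU'⟩ := exists_ultralimit_matrix hU
  obtain ⟨V', hV'⟩ := exists_ultralimit_matrix hV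
  have hd1 : ∀ i k, d k i ∈ Set.Icc (0 : ℝ) 1 := fun i k =>
    ⟨(hd k i).le, hsum k ▸ Finset.single_le_sum (fun i _ => (hd k i).le) (Finset.mem_univ i)⟩
  choose d' hd' hdlim using fun i => exists_ultralimit (hd1 i)
  have hA1 : ∀ i j k, A k i j ∈ Set.Icc (0 : ℝ) 1 := fun i j k =>
    ⟨entry_nonneg (hA k) i j, le_one_of_mem_doublyStochastic (hA k)⟩
  choose A' hA' hAlim using fun i j => exists_ultralimit (hA1 i j)
  have hεlim : Tendsto ε (hyperfilter ℕ) (𝓝 0) := hε0.mono_left Nat.hyperfilter_le_atTop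
  have hdlim' : Tendsto d (hyperfilter ℕ) (𝓝 d') := tendsto_pi_nhds.mpr hdlim
  have hstar : ∀ (W : ℕ → Mat N) (W' : Mat N), Tendsto W (hyperfilter ℕ) (𝓝 W') →
      (∀ k, (W k)ᴴ * W k = 1) → W'ᴴ * W' = 1 := by
    intro W W' h1 h2
    have hc : Continuous fun Z : Mat N => Zᴴ * Z := by fun_prop
    refine tendsto_nhds_unique ((hc.tendsto W').comp h1) ?_
    rw [show (fun Z : Mat N => Zᴴ * Z) ∘ W = fun _ => 1 from funext h2]
    exact tendsto_const_nhds
  have hUU := hstar U U' hU' hU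
  have hVV := hstar V V' hV' hV
  have hdiag : ∀ (X : ℕ → Mat N) (Y : Mat N) (j : Fin N), Tendsto X (hyperfilter ℕ) (𝓝 Y) →
      Tendsto (fun k => (((V k)ᴴ * X k * V k) j j).re) (hyperfilter ℕ)
        (𝓝 ((V'ᴴ * Y * V') j j).re) := by
    intro X Y j hXY
    have hc : Continuous fun p : Mat N × Mat N => ((p.1ᴴ * p.2 * p.1) j j).re :=
      Complex.continuous_re.comp (Continuous.matrix_elem (by fun_prop) j j)
    have h := (hc.tendsto (V', Y)).comp (hV'.prodMk_nhds hXY)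
    exact h
  have hC := tendsto_conjDiag hU' hdlim'
  have hTC := tendsto_perturb hεlim T hC
  -- The eigenvalues of the images are diagonal entries of `Vᴴ P(C) V`, so they converge along with
  -- `V` and `C`.
  set e' : Fin N → ℝ := fun j => ((V'ᴴ * T (conjDiag U' d') * V') j j).re with he'
  have helim : ∀ j, Tendsto (fun k => e k j) (hyperfilter ℕ) (𝓝 (e' j)) := by
    intro j
    have h1 := hdiag _ _ j hTC
    have h2 : ∀ k, (((V k)ᴴ * perturb T (ε k) (conjDiag (U k) (d k)) * V k) j j).re
        = e k j := fun k => by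
      rw [he k, conjTranspose_conjDiag_mul (hV k)]
      simp
    simpa only [h2] using h1
  have heq : T (conjDiag U' d') = conjDiag V' e' := by
    refine tendsto_nhds_unique hTC ?_
    simp only [he]
    exact tendsto_conjDiag hV' (tendsto_pi_nhds.mpr helim)
  have hrel : ∀ i j, A' i j * e' j = d' i * transition T U' V' i j := by
    intro i j
    have h1 := (hAlim i j).mul (helim j)
    have h2 := (hdlim i).mul (hdiag _ _ j
      (tendsto_perturb hεlim T (tendsto_conjDiag (f := fun _ => Pi.single i 1) hU' tendsto_const_nhds)))
    exact tendsto_nhds_unique h1 (h2.congr fun k => (hAe k i j).symm)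
  have hA'mem : (Matrix.of A') ∈ doublyStochastic ℝ (Fin N) := by
    rw [mem_doublyStochastic_iff_sum]
    refine ⟨fun i j => (hA' i j).1, fun i => ?_, fun j => ?_⟩
    · have h1 : Tendsto (fun k => ∑ j, A k i j) (hyperfilter ℕ) (𝓝 (∑ j, A' i j)) :=
        tendsto_finsetSum _ fun j _ => hAlim i j
      simp only [sum_row_of_mem_doublyStochastic (hA _)] at h1
      exact (tendsto_nhds_unique h1 tendsto_const_nhds)
    · have h1 : Tendsto (fun k => ∑ i, A k i j) (hyperfilter ℕ) (𝓝 (∑ i, A' i j)) :=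
        tendsto_finsetSum _ fun i _ => hAlim i j
      simp only [sum_col_of_mem_doublyStochastic (hA _)] at h1
      exact (tendsto_nhds_unique h1 tendsto_const_nhds)
  have hsum' : ∑ i, d' i = 1 := by
    have h1 : Tendsto (fun k => ∑ i, d k i) (hyperfilter ℕ) (𝓝 (∑ i, d' i)) :=
      tendsto_finsetSum _ fun i _ => hdlim i
    simp only [hsum] at h1
    exact (tendsto_nhds_unique h1 tendsto_const_nhds)
  clear_value e'
  refine ⟨U', V', d', e', Matrix.of A', hUU, hVV, fun i => (hd' i).1, hsum', heq, hA'mem, ?_, ?_⟩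
  · intro i j
    rw [of_apply, hrel]
  intro X hX
  have hdet : Continuous fun X : Mat N => X.det.re := by fun_prop
  have h1 := ((hdet.tendsto _).comp hTC).mul_const X.det.re
  have h2 := ((hdet.tendsto _).comp (tendsto_perturb hεlim T (tendsto_const_nhds (x := X)))).mul
    ((hdet.tendsto _).comp hC)
  exact le_of_tendsto_of_tendsto' h1 h2 fun k => (hopt k).2 X hX

/-- Only nonsingularity of the limit is at stake. If `d'` had zeros, every column `j` of the weights
with `e' j ≠ 0` would be supported on the support of `d'`. Mass counting would then bound the rank
of the image by the rank of `C`, against indecomposability. -/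
theorem exists_optimal_of_indecomposable (hN : 0 < N) {T : Op N} (hT : IsPositive T)
    (hind : IsIndecomposable T) : ∃ C : Mat N, Optimal T C := by
  obtain ⟨U', V', d', e', A', hUU, hVV, hd', hsum', heq, hA'mem, hrel, hle⟩ :=
    exists_limit_data hN hT
  have hne : ∀ i, d' i ≠ 0 := by
    by_contra hcon
    push Not at hcon
    obtain ⟨i₀, hi₀⟩ := hcon
    set S := Finset.univ.filter fun i => d' i ≠ 0 with hS
    set R := Finset.univ.filter fun j => e' j ≠ 0 with hR
    have hSne : S.Nonempty := by
      by_contra h0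
      rw [Finset.not_nonempty_iff_eq_empty, hS, Finset.filter_eq_empty_iff] at h0
      simp only [Finset.mem_univ, true_imp_iff, not_not] at h0
      simp [h0] at hsum'
    have hSu : S ≠ Finset.univ := fun hu => by
      have : i₀ ∈ S := hu ▸ Finset.mem_univ i₀
      simp [hS, hi₀] at this
    have hlt : S.card < R.card := by
      have := hind (conjDiag U' d') (posSemidef_conjDiag fun i => hd' i)
        (by rw [rank_conjDiag hUU]; exact hSne.card_pos)
        (by rw [rank_conjDiag hUU]; exact card_lt_of_ne_univ hSu)
      rwa [heq, rank_conjDiag hUU, rank_conjDiag hVV] at this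
    refine absurd (card_le_card_of_sum_eq_one (fun i j => entry_nonneg hA'mem i j)
      (fun i => (sum_row_of_mem_doublyStochastic hA'mem i).le) S R fun j hj => ?_)
      (not_le.mpr hlt)
    rw [← sum_col_of_mem_doublyStochastic hA'mem j]
    refine Finset.sum_subset (Finset.subset_univ _) fun i _ hi => ?_
    have hi0 : d' i = 0 := by simpa [hS] using hi
    have hj0 : e' j ≠ 0 := by simpa [hR] using hj
    have := hrel i j
    rw [hi0, zero_mul] at this
    exact (mul_eq_zero.mp this).resolve_right hj0
  exact ⟨conjDiag U' d', (posDef_conjDiag_iff hUU).mpr fun i =>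
    lt_of_le_of_ne (hd' i) (hne i).symm, hle⟩

end OperatorScaling
namespace OperatorScaling

open Matrix

variable {N : ℕ}

/-! ### Indecomposability and uniqueness of the minimizer -/

theorem eq_one_of_det_eq_one (hN : N ≤ 1) {X : Mat N} (h : X.det = 1) : X = 1 := by
  interval_cases N
  · exact Subsingleton.elim _ _
  · ext i j
    fin_cases i
    fin_cases j
    simpa using h

theorem isMinimizer_iff_of_le_one (hN : N ≤ 1) (T : Op N) {C : Mat N} :
    IsMinimizer T C ↔ C = 1 := by
  refine ⟨fun h => eq_one_of_det_eq_one hN h.2.1, ?_⟩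
  rintro rfl
  refine ⟨PosDef.one, det_one, IsLeast.csInf_eq ⟨⟨1, PosDef.one, det_one, rfl⟩, ?_⟩⟩
  rintro _ ⟨X, -, hX1, rfl⟩
  rw [eq_one_of_det_eq_one hN hX1]

/-- A projection of rank `N - 1 ≥ 1` must be mapped to a matrix of full rank. -/
theorem IsIndecomposable.posDef_map_one {T : Op N} (hind : IsIndecomposable T)
    (hT : IsPositive T) (hN : 2 ≤ N) : (T 1).PosDef := by
  set S : Finset (Fin N) := Finset.univ.erase ⟨0, by omega⟩ with hS
  have hcard : S.card = N - 1 := by simp [hS]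
  have hU : (1 : Mat N)ᴴ * 1 = 1 := by simp
  have hP := posSemidef_conjDiag_indicator (1 : Mat N) S
  have hr := rank_conjDiag_indicator hU S
  have h1 := hind _ hP (by omega) (by omega)
  refine hT.posDef_map_one hP.isHermitian ?_
  obtain ⟨V, e, hV, he⟩ := exists_conjDiag (hT _ hP).isHermitian
  rw [he] at h1 ⊢
  rw [rank_conjDiag hV] at h1
  rw [det_conjDiag hV]
  have h2 : Finset.univ.filter (fun j => e j ≠ 0) = Finset.univ := by
    apply Finset.eq_univ_of_card
    have := Finset.card_le_univ (Finset.univ.filter (fun j => e j ≠ 0))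
    rw [Fintype.card_fin] at this ⊢
    omega
  rw [Finset.filter_eq_self] at h2
  exact_mod_cast Finset.prod_ne_zero_iff.mpr h2

theorem eq_of_eq_smul {X C : Mat N} (hX : X.PosDef) (hC : C.PosDef) (hX1 : X.det = 1)
    (hC1 : C.det = 1) {s : ℝ} (h : X = (s : ℂ) • C) : X = C := by
  rcases Nat.eq_zero_or_pos N with rfl | hN
  · exact Subsingleton.elim _ _
  have hs : 0 < s := by
    have h1 := re_trace_pos hN hX
    rw [h, trace_smul, smul_eq_mul, Complex.re_ofReal_mul] at h1
    exact pos_of_mul_pos_left h1 (re_trace_pos hN hC).le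
  have h2 : s ^ N = 1 := by
    have h3 : X.det.re = s ^ N * C.det.re := by rw [← re_det_smul, ← h]
    rwa [hX1, hC1, Complex.one_re, mul_one, eq_comm] at h3
  rw [h, (pow_eq_one_iff_of_nonneg hs.le hN.ne').mp h2, Complex.ofReal_one, one_smul]

/-- Scale `T` at `C` to a doubly stochastic operator. The second minimizer becomes a `Z` whose
determinant is preserved, hence a scalar, so `X` is proportional to `C`; equal determinants finish.
-/
theorem IsIndecomposable.eq_of_isMinimizer {T : Op N} (hind : IsIndecomposable T)
    (hT : IsPositive T) {C X : Mat N} (hC : IsMinimizer T C) (hTC : (T C).PosDef)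
    (hX : IsMinimizer T X) : X = C := by
  have hds := ((isMinimizer_iff hT).mp hC).1.scaling_isDoublyStochastic hT hTC
  have h₁ := isUnit_det_power hTC (-1 / 2)
  have h₂ := isUnit_det_power hC.1 (1 / 2)
  have hCC := power_half_mul_self hC.1
  have hB : (power C (1 / 2))ᴴ = power C (1 / 2) := (isHermitian_power C _).eq
  set A := power (T C) (-1 / 2)
  set B := power C (1 / 2)
  have hBi := isUnit_nonsing_inv_det _ h₂
  set Z := (B⁻¹)ᴴ * X * B⁻¹ with hZ
  have hZpos : Z.PosDef := posDef_conjTranspose_mul_mul hBi hX.1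
  have e : Bᴴ * Z * B = X := by
    rw [hZ, conjTranspose_nonsing_inv, hB, Matrix.mul_assoc (B⁻¹), ← Matrix.mul_assoc B,
      mul_nonsing_inv _ h₂, Matrix.one_mul, Matrix.mul_assoc, nonsing_inv_mul _ h₂, Matrix.mul_one]
  have e1 : Bᴴ * 1 * B = C := by rw [hB, Matrix.mul_one, hCC]
  have hdetTX : (T X).det.re = (T C).det.re := by rw [← hX.2.2, ← hC.2.2]
  have hdetZ : Z.det.re = 1 := by
    have h1 := re_det_conjTranspose_mul_mul B Z
    have h2 := re_det_conjTranspose_mul_mul B 1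
    rw [e, hX.2.1] at h1
    rw [e1, hC.2.1, det_one, Complex.one_re, mul_one] at h2
    rw [← h2, Complex.one_re, one_mul] at h1
    exact h1.symm
  have hdetDZ : (OperatorScaling.scaling A B T Z).det.re = Z.det.re := by
    have h1 : (OperatorScaling.scaling A B T 1).det.re = 1 := by rw [hds.1, det_one, Complex.one_re]
    rw [scaling_apply, e1, re_det_mul_mul_conjTranspose] at h1
    rw [scaling_apply, e, re_det_mul_mul_conjTranspose, hdetTX, h1, hdetZ]
  obtain ⟨s, hs⟩ := hds.eq_smul_one_of_det_eq (hT.scaling A B) (hind.scaling h₁ h₂) hZpos hdetDZ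
  refine eq_of_eq_smul hX.1 hC.1 hX.2.1 hC.2.1 (s := s) ?_
  rw [← e, ← e1, hs, Matrix.mul_smul, Matrix.smul_mul]

theorem prod_comp_indicator (S : Finset (Fin N)) (f : ℝ → ℝ) :
    ∏ i, f (indicator S i) = f 1 ^ S.card * f 0 ^ (N - S.card) := by
  have h : ∀ i, f (indicator S i) = if i ∈ S then f 1 else f 0 := fun i => by
    rw [indicator]; split_ifs <;> rfl
  simp only [h, Finset.prod_ite, Finset.prod_const, Finset.filter_mem_eq_inter, Finset.univ_inter]
  congr 2
  rw [Finset.filter_not, Finset.filter_mem_eq_inter, Finset.univ_inter,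
    Finset.card_sdiff_of_subset (Finset.subset_univ _), Finset.card_univ, Fintype.card_fin]

/-- Two minimizers which are not proportional contradict uniqueness. -/
theorem exists_smul_eq_of_unique {T : Op N} (hT : IsPositive T)
    (huniq : ∃! C : Mat N, IsMinimizer T C) {X Y : Mat N} (hX : Optimal T X) (hY : Optimal T Y) :
    ∃ c c' : ℝ, 0 < c ∧ (c : ℂ) • X = (c' : ℂ) • Y := by
  obtain ⟨c, hc, h1⟩ := hX.exists_minimizer hT
  obtain ⟨c', -, h2⟩ := hY.exists_minimizer hT
  exact ⟨c, c', hc, huniq.unique h1 h2⟩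

theorem conjDiag_eq_of_smul_eq {U : Mat N} (hU : Uᴴ * U = 1) {d : Fin N → ℝ} {c c' : ℝ}
    (hc : 0 < c) (h : (c : ℂ) • conjDiag U d = (c' : ℂ) • 1) (i k : Fin N) : d i = d k := by
  rw [conjDiag_smul, ← conjDiag_const hU] at h
  have h1 := congrArg (fun Z => Uᴴ * Z * U) h
  simp only [conjTranspose_conjDiag_mul hU] at h1
  have h2 := diagonal_injective h1
  have h3 : ∀ j, c * d j = c' := fun j => by exact_mod_cast congrFun h2 j
  exact mul_left_cancel₀ hc.ne' ((h3 i).trans (h3 k).symm)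

theorem indecomposable_of_unique {T : Op N} (hT : IsPositive T)
    (huniq : ∃! C : Mat N, IsMinimizer T C) : IsIndecomposable T := by
  by_contra hind
  obtain ⟨C, hC⟩ := huniq.exists
  rcases (capacity_nonneg hT).eq_or_lt with hcap | hcap
  -- At capacity zero the attained minimum makes `det T` vanish on all positive definite matrices,
  -- so everything is optimal. A decomposable `T` requires `N ≥ 2`, where a diagonal matrix with
  -- distinct positive entries is not proportional to `1`.
  · have hN : 2 ≤ N := by
      rw [IsIndecomposable] at hind
      push Not at hind
      obtain ⟨X, -, h1, h2, -⟩ := hind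
      omega
    have hall : ∀ X : Mat N, X.PosDef → Optimal T X := fun X hX => by
      have hdet : ∀ Y : Mat N, Y.PosDef → (T Y).det = 0 := fun Y hY => by
        by_contra hne
        have h1 := hT.posDef_map (hT.posDef_map_one hY.isHermitian hne) hC.1
        have h2 := re_det_pos h1
        rw [← hC.2.2, ← hcap] at h2
        exact lt_irrefl _ h2
      refine ⟨hX, fun Y hY => ?_⟩
      rw [hdet X hX, hdet Y hY]
      simp
    have hU : (1 : Mat N)ᴴ * 1 = 1 := by simp
    obtain ⟨c, c', hc, h1⟩ := exists_smul_eq_of_unique hT huniq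
      (hall (conjDiag 1 fun i => (i : ℝ) + 1) ((posDef_conjDiag_iff hU).mpr fun i => by positivity))
      (hall 1 PosDef.one)
    have h2 := conjDiag_eq_of_smul_eq hU hc h1 ⟨0, by omega⟩ ⟨1, by omega⟩
    norm_num at h2
  · have hTC := posDef_of_capacity_pos hT hcap hC
    have hds := ((isMinimizer_iff hT).mp hC).1.scaling_isDoublyStochastic hT hTC
    have h₁ := isUnit_det_power hTC (-1 / 2)
    have h₂ := isUnit_det_power hC.1 (1 / 2)
    set A := power (T C) (-1 / 2)
    set B := power C (1 / 2)
    have hD := hT.scaling A B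
    have hDind : ¬ IsIndecomposable (scaling A B T) := fun h => hind (by
      have := h.scaling (isUnit_nonsing_inv_det _ h₁) (isUnit_nonsing_inv_det _ h₂)
      rwa [scaling_inv_scaling h₁ h₂] at this)
    obtain ⟨U, V, S, R, hU, hV, ⟨i, hi⟩, hSu, hcard, hSR⟩ := hds.exists_projection hD hDind
    obtain ⟨k, hk⟩ : ∃ k, k ∉ S := by simpa [Finset.ext_iff] using hSu
    have hmap := hds.map_conjDiag_of_indicator hU hV hSR 1 1
    -- `Z = 1 + P` maps to `1 + P'` with `P`, `P'` projections of equal rank. The determinant is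
    -- preserved, so `Z` is a nonscalar minimizer beside `1`.
    set Z := conjDiag U fun i => 1 * indicator S i + 1 with hZ
    have hZpos : Z.PosDef := (posDef_conjDiag_iff hU).mpr fun i => by
      rw [indicator]; split_ifs <;> norm_num
    have hdet : (scaling A B T Z).det.re = Z.det.re := by
      rw [hmap, hZ, det_conjDiag hU, det_conjDiag hV, prod_comp_indicator R fun x => 1 * x + 1,
        prod_comp_indicator S fun x => 1 * x + 1, hcard]
    have hopt := (hds.optimal_of_det_eq hD hZpos hdet).of_scaling h₁ h₂
    have hopt1 := (hds.optimal_of_det_eq hD PosDef.one (by rw [hds.1])).of_scaling h₁ h₂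
    obtain ⟨c, c', hc, h1⟩ := exists_smul_eq_of_unique hT huniq hopt hopt1
    have h2 : (c : ℂ) • Z = (c' : ℂ) • 1 := by
      have hBu : IsUnit B := (isUnit_iff_isUnit_det _).mpr h₂
      have hBu' : IsUnit Bᴴ := (isUnit_iff_isUnit_det _).mpr (by
        rw [det_conjTranspose]; exact h₂.star)
      have h3 : Bᴴ * ((c : ℂ) • Z) * B = Bᴴ * ((c' : ℂ) • 1) * B := by
        simpa only [Matrix.mul_smul, Matrix.smul_mul] using h1
      exact hBu'.mul_left_cancel (hBu.mul_right_cancel h3)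
    have h3 := conjDiag_eq_of_smul_eq hU hc h2 i k
    simp [indicator, hi, hk] at h3

theorem indecomposable_iff_unique {T : Op N} (hT : IsPositive T) :
    IsIndecomposable T ↔ ∃! C : Mat N, IsMinimizer T C := by
  refine ⟨fun hind => ?_, indecomposable_of_unique hT⟩
  rcases Nat.lt_or_ge 1 N with hN | hN
  · obtain ⟨C, hC⟩ := exists_optimal_of_indecomposable (by omega) hT hind
    obtain ⟨c, hc, hmin⟩ := hC.exists_minimizer hT
    exact ⟨_, hmin, fun X hX => hind.eq_of_isMinimizer hT hmin
      (hT.posDef_map (hind.posDef_map_one hT hN) hmin.1) hX⟩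
  · exact ⟨1, (isMinimizer_iff_of_le_one hN T).mpr rfl,
      fun X hX => (isMinimizer_iff_of_le_one hN T).mp hX⟩

theorem IsIndecomposable.exists_scaling {T : Op N} (hind : IsIndecomposable T)
    (hT : IsPositive T) (h0 : T ≠ 0) :
    ∃ C₁ C₂ : Mat N, IsUnit C₁.det ∧ IsUnit C₂.det ∧
      IsDoublyStochastic (OperatorScaling.scaling C₁ C₂ T) := by
  obtain ⟨C, hC, -⟩ := (indecomposable_iff_unique hT).mp hind
  have hT1 : (T 1).PosDef := by
    rcases Nat.lt_or_ge 1 N with hN | hN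
    · exact hind.posDef_map_one hT hN
    -- For `N = 1` indecomposability is vacuous and admits `T = 0`; this is where `T ≠ 0` is needed.
    -- For `N = 0` every operator is zero.
    · interval_cases N
      · exact absurd (Subsingleton.elim _ _) h0
      · rw [(hT _ PosSemidef.one).posDef_iff_det_ne_zero]
        intro h1
        apply h0
        ext1 X
        have hX : X = X 0 0 • (1 : Mat 1) := by
          ext i j
          fin_cases i
          fin_cases j
          simp
        have h2 : T 1 = 0 := by
          ext i j
          fin_cases i
          fin_cases j
          simpa using h1
        rw [hX, map_smul, h2, smul_zero, LinearMap.zero_apply]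
  have hTC := hT.posDef_map hT1 hC.1
  exact ⟨_, _, isUnit_det_power hTC _, isUnit_det_power hC.1 _,
    ((isMinimizer_iff hT).mp hC).1.scaling_isDoublyStochastic hT hTC⟩

end OperatorScaling
namespace OperatorScaling

open Matrix

variable {N : ℕ}

/-! ### The potential estimate for doubly stochastic operators -/

/-- Use `X ⪰ m` twice: paired with `E X E` it replaces the first `X` by `m`, and paired with `E²` it
replaces the second. -/
theorem trace_sq_le_trace_mul_mul_mul {X E : Mat N} {m : ℝ} (hm : 0 < m)
    (hX : (X - (m : ℂ) • 1).PosSemidef) (hE : E.IsHermitian) :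
    m ^ 2 * ((E ^ 2).trace).re ≤ ((X * E * X * E).trace).re := by
  have hXp := posDef_of_bound hm hX
  have h1 : 0 ≤ (((X - (m : ℂ) • 1) * (E * X * Eᴴ)).trace).re :=
    (Complex.le_def.mp (trace_mul_nonneg hX (hXp.posSemidef.mul_mul_conjTranspose_same E))).1
  have h2 : 0 ≤ (((X - (m : ℂ) • 1) * (E * Eᴴ)).trace).re :=
    (Complex.le_def.mp (trace_mul_nonneg hX (posSemidef_self_mul_conjTranspose E))).1
  have key : ∀ Q : Mat N, (((X - (m : ℂ) • 1) * Q).trace).re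
      = ((X * Q).trace).re - m * (Q.trace).re := fun Q => by
    rw [Matrix.sub_mul, trace_sub, Complex.sub_re, Matrix.smul_mul, Matrix.one_mul, trace_smul,
      smul_eq_mul, Complex.re_ofReal_mul]
  rw [key, hE.eq] at h1 h2
  have e1 : X * (E * X * E) = X * E * X * E := by simp only [Matrix.mul_assoc]
  have e2 : (E * X * E).trace = (X * (E * E)).trace := by
    rw [Matrix.mul_assoc, Matrix.trace_mul_comm, Matrix.mul_assoc]
  rw [e1, e2] at h1
  rw [sq E]
  nlinarith

/-- Expand `tr((l E - Y)²) ≥ 0`. -/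
theorem two_mul_re_trace_mul_le {E Y : Mat N} (hE : E.IsHermitian) (hY : Y.IsHermitian) (l : ℝ) :
    2 * l * ((E * Y).trace).re ≤ l ^ 2 * ((E ^ 2).trace).re + ((Y ^ 2).trace).re := by
  have hl : ((l : ℂ) • E - Y).IsHermitian := by
    refine IsHermitian.sub ?_ hY
    rw [IsHermitian, conjTranspose_smul, hE.eq, RCLike.star_def, Complex.conj_ofReal]
  have h := re_trace_sq_nonneg hl
  have e : ((l : ℂ) • E - Y) ^ 2
      = ((l ^ 2 : ℝ) : ℂ) • (E ^ 2) - (l : ℂ) • (E * Y) - (l : ℂ) • (Y * E) + Y ^ 2 := by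
    rw [sq, sq, sq, Matrix.sub_mul, Matrix.mul_sub, Matrix.mul_sub]
    simp only [Matrix.smul_mul, Matrix.mul_smul, smul_smul, Complex.ofReal_mul, sq]
    abel
  rw [e, trace_add, trace_sub, trace_sub, trace_smul, trace_smul, trace_smul,
    Matrix.trace_mul_comm Y E] at h
  simp only [Complex.add_re, Complex.sub_re, smul_eq_mul, Complex.re_ofReal_mul] at h
  linarith

theorem inv_bound {Z : Mat N} {m : ℝ} (hm : 0 < m) (hZ : (Z - (m : ℂ) • 1).PosSemidef) :
    (((m⁻¹ : ℝ) : ℂ) • 1 - Z⁻¹).PosSemidef := by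
  have hZp := posDef_of_bound hm hZ
  obtain ⟨U, d, hU, rfl⟩ := exists_conjDiag hZp.isHermitian
  rw [conjDiag_bound_iff hU] at hZ
  rw [inv_conjDiag hU fun i => (hm.trans_le (hZ i)).ne', conjDiag_bound_iff' hU]
  exact fun i => inv_anti₀ hm (hZ i)

theorem inv_bound' {Z : Mat N} {M : ℝ} (hZp : Z.PosDef) (hZ : ((M : ℂ) • 1 - Z).PosSemidef) :
    (Z⁻¹ - ((M⁻¹ : ℝ) : ℂ) • 1).PosSemidef := by
  obtain ⟨U, d, hU, rfl⟩ := exists_conjDiag hZp.isHermitian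
  rw [conjDiag_bound_iff' hU] at hZ
  rw [posDef_conjDiag_iff hU] at hZp
  rw [inv_conjDiag hU fun i => (hZp i).ne', conjDiag_bound_iff hU]
  exact fun i => inv_anti₀ (hZp i) (hZ i)

namespace IsDoublyStochastic

variable {T : Op N} (h : IsDoublyStochastic T) (hT : IsPositive T)
include h hT

theorem map_bound {Z : Mat N} {m : ℝ} (hZ : (Z - (m : ℂ) • 1).PosSemidef) :
    (T Z - (m : ℂ) • 1).PosSemidef := by
  have := hT _ hZ
  rwa [map_sub, map_smul, h.1] at this

theorem map_bound' {Z : Mat N} {m : ℝ} (hZ : ((m : ℂ) • 1 - Z).PosSemidef) :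
    ((m : ℂ) • 1 - T Z).PosSemidef := by
  have := hT _ hZ
  rwa [map_sub, map_smul, h.1] at this

/-- The logarithmic determinant gap is controlled by the defect in the critical point equation. -/
theorem log_det_gap_le (hN : 0 < N) {a : ℝ} (ha1 : a < 1)
    (hgap : ∀ X : Mat N, X.IsHermitian → X.trace = 0 →
      (((T X) ^ 2).trace).re ≤ a * ((X ^ 2).trace).re)
    {m M : ℝ} (hm : 0 < m) (hM : 0 < M) :
    ∃ K : ℝ, 0 < K ∧ ∀ X : Mat N, (X - (m : ℂ) • 1).PosSemidef → ((M : ℂ) • 1 - X).PosSemidef →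
      Real.log (T X).det.re - Real.log X.det.re
        ≤ K * (((OperatorScaling.dual T ((T X)⁻¹) - X⁻¹) ^ 2).trace).re := by
  set k : ℝ := m * ((M ^ 3)⁻¹ * (1 - a)) with hk
  have hk0 : 0 < k := by
    have := sub_pos.mpr ha1
    positivity
  refine ⟨(m ^ 2)⁻¹ * (k⁻¹) ^ 2, by positivity, fun X hXm hXM => ?_⟩
  have hX := posDef_of_bound hm hXm
  have hTX := h.posDef_map hT hX
  have hEherm : (OperatorScaling.dual T ((T X)⁻¹) - X⁻¹).IsHermitian :=
    (hT.dual.isHermitian_map hTX.inv.isHermitian).sub hX.inv.isHermitian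
  obtain ⟨U, d, hU, rfl⟩ := exists_conjDiag hX.isHermitian
  obtain ⟨V, e, hV, he⟩ := exists_conjDiag hTX.isHermitian
  have hA := h.transition_mem hT hU hV
  have hde := vecMul_transition_eq hV he
  have hd0 := (posDef_conjDiag_iff hU).mp hX
  have he0 := (posDef_conjDiag_iff hV).mp (he ▸ hTX)
  rw [conjDiag_bound_iff hU] at hXm
  rw [conjDiag_bound_iff' hU] at hXM
  have hvar := sum_sq_sub_sum_sq hA d
  have hlog := sum_log_sub_sum_log_le hA hm hXm
  have hinv := variance_le_sum_inv_sub hA hd0 hXM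
  have hmean := sum_sub_sum_eq hA d d (d ᵥ* transition T U V) (fun _ => 1)
  rw [hde] at hvar hlog hinv hmean
  simp only [mul_one, sub_self, mul_zero, Finset.sum_const_zero] at hmean
  have hNr : (0 : ℝ) < N := by exact_mod_cast hN
  set c : ℝ := (∑ i, d i) / N with hc
  have hcN : c * N = ∑ i, d i := div_mul_cancel₀ _ hNr.ne'
  have hcm : m ≤ c := by
    rw [hc, le_div_iff₀ hNr]
    calc m * N = ∑ _i : Fin N, m := by simp [mul_comm]
      _ ≤ ∑ i, d i := Finset.sum_le_sum fun i _ => hXm i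
  -- The traceless part of `X`, with `c` the mean eigenvalue. By the gap and `D(1) = 1`, the
  -- variance lies between `(1 - a) tr Y²` and `tr Y²`.
  set Y := conjDiag U d - (c : ℂ) • 1 with hY
  have hYdiag : Y = conjDiag U fun i => d i - c := by
    rw [hY, ← conjDiag_const hU, conjDiag_sub]
  have hTYdiag : T Y = conjDiag V fun i => e i - c := by
    rw [hY, map_sub, map_smul, h.1, he, ← conjDiag_const hV, conjDiag_sub]
  have hYherm : Y.IsHermitian := hYdiag ▸ isHermitian_conjDiag
  have hYtr : Y.trace = 0 := by
    rw [hYdiag, trace_conjDiag hU, ← Complex.ofReal_zero]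
    congr 1
    rw [Finset.sum_sub_distrib, ← hcN]
    simp [mul_comm]
  have hg := hgap Y hYherm hYtr
  have hexp : ∀ f : Fin N → ℝ, ∑ i, f i = c * N → ∑ i, (f i - c) ^ 2 = ∑ i, f i ^ 2 - c ^ 2 * N := by
    intro f hf
    have : ∀ i, (f i - c) ^ 2 = f i ^ 2 - 2 * c * f i + c ^ 2 := fun i => by ring
    simp only [this, Finset.sum_add_distrib, Finset.sum_sub_distrib, ← Finset.mul_sum, hf,
      Finset.sum_const, Finset.card_univ, Fintype.card_fin, nsmul_eq_mul]
    ring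
  have hYd : ((Y ^ 2).trace).re = ∑ i, d i ^ 2 - c ^ 2 * N := by
    rw [hYdiag, re_trace_sq_conjDiag hU, hexp d hcN.symm]
  have hYe : ((T Y ^ 2).trace).re = ∑ i, e i ^ 2 - c ^ 2 * N := by
    rw [hTYdiag, re_trace_sq_conjDiag hV, hexp e (by linarith)]
  have hTY0 := re_trace_sq_nonneg (hT.isHermitian_map hYherm)
  have hv1 : (1 - a) * ((Y ^ 2).trace).re ≤ variance (transition T U V) d := by
    rw [← hvar]; linarith
  have hv2 : variance (transition T U V) d ≤ ((Y ^ 2).trace).re := by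
    rw [← hvar]; linarith
  -- The defect has zero pairing with `X`, so pairing it with `Y = X - c·1` leaves `-c` times its
  -- trace.
  have hpair : (((OperatorScaling.dual T ((T (conjDiag U d))⁻¹) - (conjDiag U d)⁻¹) * Y).trace).re
      = c * (∑ i, (d i)⁻¹ - ∑ i, (e i)⁻¹) := by
    have hu1 := (isUnit_iff_isUnit_det _).mp hX.isUnit
    have hu2 := (isUnit_iff_isUnit_det _).mp hTX.isUnit
    have t1 : (OperatorScaling.dual T ((T (conjDiag U d))⁻¹) * conjDiag U d).trace = N := by
      rw [Matrix.trace_mul_comm, ← hT.trace_map_mul, mul_nonsing_inv _ hu2, trace_one,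
        Fintype.card_fin]
    have t2 : ((conjDiag U d)⁻¹ * conjDiag U d).trace = N := by
      rw [nonsing_inv_mul _ hu1, trace_one, Fintype.card_fin]
    have t3 : (OperatorScaling.dual T ((T (conjDiag U d))⁻¹)).trace
        = ((∑ i, (e i)⁻¹ : ℝ) : ℂ) := by
      rw [← Matrix.one_mul (OperatorScaling.dual T _), ← hT.trace_map_mul, h.1, Matrix.one_mul, he,
        inv_conjDiag hV fun i => (he0 i).ne', trace_conjDiag hV]
    have t4 : ((conjDiag U d)⁻¹).trace = ((∑ i, (d i)⁻¹ : ℝ) : ℂ) := by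
      rw [inv_conjDiag hU fun i => (hd0 i).ne', trace_conjDiag hU]
    rw [hY, Matrix.mul_sub, Matrix.mul_smul, Matrix.mul_one, Matrix.sub_mul, trace_sub, trace_sub,
      t1, t2, sub_self, zero_sub, trace_smul, trace_sub, t3, t4, ← Complex.ofReal_sub,
      smul_eq_mul, ← Complex.ofReal_mul, ← Complex.ofReal_neg, Complex.ofReal_re]
    ring
  -- With `s = tr Y²` and `E` the defect, `k s ≤ tr(E Y)`. The weight `k⁻¹` then yields `2 s ≤ k⁻²
  -- tr E² + s`, so `s` is absorbed.
  have hCS := two_mul_re_trace_mul_le hEherm hYherm k⁻¹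
  rw [hpair] at hCS
  set s := ((Y ^ 2).trace).re
  have hs0 : 0 ≤ s := re_trace_sq_nonneg hYherm
  have hks : k * s ≤ c * (∑ i, (d i)⁻¹ - ∑ i, (e i)⁻¹) := by
    have hM3 : 0 < (M ^ 3)⁻¹ := by positivity
    have h1 : (M ^ 3)⁻¹ * ((1 - a) * s) ≤ ∑ i, (d i)⁻¹ - ∑ i, (e i)⁻¹ :=
      (mul_le_mul_of_nonneg_left hv1 hM3.le).trans hinv
    have h2 : 0 ≤ (M ^ 3)⁻¹ * ((1 - a) * s) := by
      have := sub_pos.mpr ha1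
      positivity
    calc k * s = m * ((M ^ 3)⁻¹ * ((1 - a) * s)) := by rw [hk]; ring
      _ ≤ c * ((M ^ 3)⁻¹ * ((1 - a) * s)) := mul_le_mul_of_nonneg_right hcm h2
      _ ≤ _ := mul_le_mul_of_nonneg_left h1 (hm.le.trans hcm)
  have h5 : 2 * k⁻¹ * (k * s) ≤ 2 * k⁻¹ * (c * (∑ i, (d i)⁻¹ - ∑ i, (e i)⁻¹)) :=
    mul_le_mul_of_nonneg_left hks (by positivity)
  have h6 : 2 * k⁻¹ * (k * s) = 2 * s := by
    field_simp
  rw [h6] at h5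
  set q := (((OperatorScaling.dual T ((T (conjDiag U d))⁻¹) - (conjDiag U d)⁻¹) ^ 2).trace).re
  have h7 : s ≤ k⁻¹ ^ 2 * q := by linarith
  rw [he, log_det_conjDiag hU hd0, log_det_conjDiag hV he0, mul_assoc]
  exact hlog.trans (mul_le_mul_of_nonneg_left (hv2.trans h7) (by positivity))

end IsDoublyStochastic

/-! ### Decrease of the potential -/

/-- Apply `log y ≤ y - 1` at `y = √x`: the gain over `x - 1` is `(y - 1)² = (x - 1)² / (y + 1)²`,
and `(y + 1)² ≤ 2x + 2`. -/
theorem log_le_sub_sq {x b : ℝ} (hx : 0 < x) (hxb : x ≤ b) :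
    Real.log x ≤ x - 1 - (x - 1) ^ 2 / (2 * b + 2) := by
  have hy := Real.sqrt_pos.mpr hx
  have hyx := Real.sq_sqrt hx.le
  set y := √x
  have h1 : Real.log x = 2 * Real.log y := by
    rw [← hyx, Real.log_pow]
    norm_num
  have h2 := Real.log_le_sub_one_of_pos hy
  have h3 : (x - 1) ^ 2 / (2 * b + 2) ≤ (y - 1) ^ 2 := by
    rw [div_le_iff₀ (by linarith), ← hyx]
    have h4 : (y + 1) ^ 2 ≤ 2 * b + 2 := by nlinarith [sq_nonneg (y - 1)]
    calc (y ^ 2 - 1) ^ 2 = (y - 1) ^ 2 * (y + 1) ^ 2 := by ring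
      _ ≤ (y - 1) ^ 2 * (2 * b + 2) := mul_le_mul_of_nonneg_left h4 (sq_nonneg _)
  nlinarith

/-- Positive eigenvalues with sum `N` are each at most `N`, and the linear terms of the logarithmic
bound cancel in the sum. -/
theorem re_trace_sq_le_log_det {X : Mat N} (hX : X.PosDef) (htr : X.trace = N) :
    (((X - 1) ^ 2).trace).re ≤ (2 * N + 2) * -Real.log X.det.re := by
  obtain ⟨U, d, hU, rfl⟩ := exists_conjDiag hX.isHermitian
  have hd := (posDef_conjDiag_iff hU).mp hX
  rw [trace_conjDiag hU] at htr
  have hsum : ∑ i, d i = N := by exact_mod_cast htr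
  have h1 : conjDiag U d - 1 = conjDiag U fun i => d i - 1 := by
    have := conjDiag_const hU 1
    rw [Complex.ofReal_one, one_smul] at this
    rw [← this, conjDiag_sub]
  rw [h1, re_trace_sq_conjDiag hU, log_det_conjDiag hU hd]
  have h2 : ∑ i, Real.log (d i) ≤ ∑ i, (d i - 1 - (d i - 1) ^ 2 / (2 * N + 2)) :=
    Finset.sum_le_sum fun i _ => log_le_sub_sq (hd i)
      (hsum ▸ Finset.single_le_sum (fun i _ => (hd i).le) (Finset.mem_univ i))
  rw [Finset.sum_sub_distrib, Finset.sum_sub_distrib, hsum, ← Finset.sum_div] at h2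
  simp only [Finset.sum_const, Finset.card_univ, Fintype.card_fin, nsmul_eq_mul, mul_one, sub_self,
    zero_sub] at h2
  rw [mul_comm, ← div_le_iff₀ (by positivity)]
  linarith

end OperatorScaling
namespace OperatorScaling

open Matrix

variable {N : ℕ}

/-! ### Operator Sinkhorn scaling -/

/-- The accumulated left factor of the operator Sinkhorn iteration. -/
noncomputable def leftFactor (T : Op N) (A : Mat N) : ℕ → Mat N
  | 0 => A
  | n + 1 => if Even n then power (OSI T n 1) (-1 / 2) * leftFactor T A n else leftFactor T A n

/-- The accumulated right factor of the operator Sinkhorn iteration. -/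
noncomputable def rightFactor (T : Op N) (B : Mat N) : ℕ → Mat N
  | 0 => B
  | n + 1 => if Even n then rightFactor T B n
      else power (dual (OSI T n) 1) (-1 / 2) * rightFactor T B n

/-- The logarithm of the inverse capacity of a scaling of a doubly stochastic operator. -/
noncomputable def potential (A B : Mat N) : ℝ :=
  -(Real.log (Complex.normSq A.det) + Real.log (Complex.normSq B.det))

theorem OSI_succ_of_even (T : Op N) {n : ℕ} (hn : Even n) : OSI T (n + 1) = rowScaling (OSI T n) := by
  rw [OSI, if_pos hn]

theorem OSI_succ_of_odd (T : Op N) {n : ℕ} (hn : ¬ Even n) :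
    OSI T (n + 1) = colScaling (OSI T n) := by
  rw [OSI, if_neg hn]

theorem OSI_eq_scaling {T D : Op N} {A B : Mat N} (hTD : T = scaling A B D) (n : ℕ) :
    OSI T n = scaling (leftFactor T A n) (rightFactor T B n) D := by
  induction n with
  | zero => exact hTD
  | succ n ih =>
    by_cases hn : Even n
    · rw [OSI_succ_of_even T hn, rowScaling, leftFactor, rightFactor, if_pos hn, if_pos hn]
      nth_rw 2 [ih]
      rw [scaling_scaling, Matrix.one_mul]
    · rw [OSI_succ_of_odd T hn, colScaling, leftFactor, rightFactor, if_neg hn, if_neg hn]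
      nth_rw 2 [ih]
      rw [scaling_scaling, Matrix.one_mul]

theorem log_normSq_det_power_mul {P A : Mat N} (hP : P.PosDef) (hA : IsUnit A.det) :
    Real.log (Complex.normSq (power P (-1 / 2) * A).det)
      = Real.log (Complex.normSq A.det) - Real.log P.det.re := by
  have h1 : Complex.normSq (power P (-1 / 2)).det * P.det.re = 1 := by
    rw [← re_det_mul_mul_conjTranspose, (isHermitian_power P _).eq, power_neg_half_mul_mul hP,
      det_one, Complex.one_re]
  have hp := Complex.normSq_pos.mpr (isUnit_det_power hP (-1 / 2)).ne_zero
  have ha := Complex.normSq_pos.mpr hA.ne_zero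
  have h2 := congrArg Real.log h1
  rw [Real.log_mul hp.ne' (re_det_pos hP).ne', Real.log_one] at h2
  rw [det_mul, Complex.normSq_mul, Real.log_mul hp.ne' ha.ne']
  linarith

theorem rowScaling_apply_one {T : Op N} (h : (T 1).PosDef) : rowScaling T 1 = 1 := by
  rw [rowScaling, scaling_apply, conjTranspose_one, Matrix.one_mul, Matrix.one_mul,
    (isHermitian_power _ _).eq, power_neg_half_mul_mul h]

theorem dual_colScaling_apply_one {T : Op N} (hT : IsPositive T) (h : (dual T 1).PosDef) :
    dual (colScaling T) 1 = 1 := by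
  rw [colScaling, hT.dual_scaling_apply, conjTranspose_one, Matrix.one_mul, Matrix.one_mul,
    (isHermitian_power _ _).eq, power_neg_half_mul_mul h]

section Iteration

variable {T D : Op N} {A B : Mat N} (hTD : T = scaling A B D) (hD : IsPositive D)
  (hds : IsDoublyStochastic D) (hA : IsUnit A.det) (hB : IsUnit B.det)
include hTD hD hds hA hB

omit hds hA hB in
theorem OSI_isPositive (n : ℕ) : IsPositive (OSI T n) := by
  rw [OSI_eq_scaling hTD n]
  exact hD.scaling _ _

theorem OSI_marginals (n : ℕ) : IsUnit (leftFactor T A n).det ∧ IsUnit (rightFactor T B n).det ∧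
    (OSI T n 1).PosDef ∧ (dual (OSI T n) 1).PosDef := by
  have key : ∀ n, IsUnit (leftFactor T A n).det → IsUnit (rightFactor T B n).det →
      (OSI T n 1).PosDef ∧ (dual (OSI T n) 1).PosDef := by
    intro n h₁ h₂
    rw [OSI_eq_scaling hTD n, scaling_apply, hD.dual_scaling_apply]
    exact ⟨posDef_mul_mul_conjTranspose h₁
        (hds.posDef_map hD (posDef_conjTranspose_mul_mul h₂ PosDef.one)),
      posDef_mul_mul_conjTranspose h₂ ((hds.dual hD).posDef_map hD.dual
        (posDef_conjTranspose_mul_mul h₁ PosDef.one))⟩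
  induction n with
  | zero => exact ⟨hA, hB, key 0 hA hB⟩
  | succ n ih =>
    obtain ⟨h₁, h₂, hr, hc⟩ := ih
    have h₁' : IsUnit (leftFactor T A (n + 1)).det := by
      rw [leftFactor]
      split_ifs
      · rw [det_mul]
        exact (isUnit_det_power hr _).mul h₁
      · exact h₁
    have h₂' : IsUnit (rightFactor T B (n + 1)).det := by
      rw [rightFactor]
      split_ifs
      · exact h₂
      · rw [det_mul]
        exact (isUnit_det_power hc _).mul h₂
    exact ⟨h₁', h₂', key _ h₁' h₂'⟩

theorem OSI_succ_row {n : ℕ} (hn : Even n) : OSI T (n + 1) 1 = 1 := by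
  rw [OSI_succ_of_even T hn, rowScaling_apply_one (OSI_marginals hTD hD hds hA hB n).2.2.1]

theorem OSI_succ_col {n : ℕ} (hn : ¬ Even n) : dual (OSI T (n + 1)) 1 = 1 := by
  rw [OSI_succ_of_odd T hn, dual_colScaling_apply_one (OSI_isPositive hTD hD n)
    (OSI_marginals hTD hD hds hA hB n).2.2.2]

theorem DS_OSI_nonneg (n : ℕ) : 0 ≤ DS (OSI T n) := by
  have h := OSI_marginals hTD hD hds hA hB n
  rw [DS, Complex.add_re]
  exact add_nonneg (re_trace_sq_nonneg (h.2.2.1.isHermitian.sub isHermitian_one))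
    (re_trace_sq_nonneg (h.2.2.2.isHermitian.sub isHermitian_one))

/-- After a step one marginal is `I`, so the other, `P`, has trace `N` and is the whole of `DS`. The
next step normalizes `P` and lowers the potential by `-log det P`. -/
theorem DS_le_potential_sub (n : ℕ) : DS (OSI T (n + 1)) ≤ (2 * N + 2) *
    (potential (leftFactor T A (n + 1)) (rightFactor T B (n + 1))
      - potential (leftFactor T A (n + 2)) (rightFactor T B (n + 2))) := by
  obtain ⟨h₁, h₂, hr, hc⟩ := OSI_marginals hTD hD hds hA hB (n + 1)
  have hpos := OSI_isPositive hTD hD (n + 1)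
  have htr := hpos.trace_map 1
  rw [Matrix.one_mul] at htr
  by_cases hn : Even n
  · have hn' : ¬ Even (n + 1) := by rw [Nat.even_add_one]; exact not_not.mpr hn
    have h1 := OSI_succ_row hTD hD hds hA hB hn
    have e1 : leftFactor T A (n + 2) = leftFactor T A (n + 1) := by
      rw [leftFactor, if_neg hn']
    have e2 : rightFactor T B (n + 2)
        = power (dual (OSI T (n + 1)) 1) (-1 / 2) * rightFactor T B (n + 1) := by
      rw [rightFactor, if_neg hn']
    rw [h1, trace_one, Fintype.card_fin] at htr
    rw [e1, e2, potential, potential, log_normSq_det_power_mul hc h₂, DS, h1]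
    have := re_trace_sq_le_log_det hc htr.symm
    simp only [sub_self, ne_eq, OfNat.ofNat_ne_zero, not_false_eq_true, zero_pow, trace_zero,
      zero_add]
    refine this.trans_eq ?_
    ring
  · have hn' : Even (n + 1) := by rw [Nat.even_add_one]; exact hn
    have h1 := OSI_succ_col hTD hD hds hA hB hn
    have e1 : rightFactor T B (n + 2) = rightFactor T B (n + 1) := by
      rw [rightFactor, if_pos hn']
    have e2 : leftFactor T A (n + 2)
        = power (OSI T (n + 1) 1) (-1 / 2) * leftFactor T A (n + 1) := by
      rw [leftFactor, if_pos hn']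
    rw [h1, trace_one, Fintype.card_fin] at htr
    rw [e1, e2, potential, potential, log_normSq_det_power_mul hr h₁, DS, h1]
    have := re_trace_sq_le_log_det hr htr
    simp only [sub_self, ne_eq, OfNat.ofNat_ne_zero, not_false_eq_true, zero_pow, trace_zero,
      add_zero]
    refine this.trans_eq ?_
    ring

omit hTD hds hD hB in
-- Row normalization gives `|det A|⁻² = det D(BᴴB)`, which identifies the potential with a
-- log-determinant gap of `D`.
theorem potential_eq_of_row (h1 : (scaling A B D) 1 = 1) :
    potential A B = Real.log (D (Bᴴ * B)).det.re - Real.log (Bᴴ * B).det.re := by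
  have h2 := re_det_mul_mul_conjTranspose A (D (Bᴴ * B))
  have h3 : A * D (Bᴴ * B) * Aᴴ = 1 := by
    rw [scaling_apply, Matrix.mul_one] at h1
    exact h1
  have h4 := re_det_conjTranspose_mul_mul B 1
  rw [h3, det_one, Complex.one_re] at h2
  rw [Matrix.mul_one, det_one, Complex.one_re, mul_one] at h4
  have h5 : (D (Bᴴ * B)).det.re ≠ 0 := by
    intro h0
    rw [h0, mul_zero] at h2
    exact one_ne_zero h2
  have h6 := congrArg Real.log h2
  rw [Real.log_one, Real.log_mul (Complex.normSq_pos.mpr hA.ne_zero).ne' h5] at h6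
  rw [potential, h4]
  linarith

omit hTD in
theorem potential_nonneg_of_row (h1 : (scaling A B D) 1 = 1) : 0 ≤ potential A B := by
  have hX : (Bᴴ * B).PosDef := by
    have := posDef_conjTranspose_mul_mul hB PosDef.one
    rwa [Matrix.mul_one] at this
  rw [potential_eq_of_row hA h1, sub_nonneg]
  exact Real.log_le_log (re_det_pos hX) (hds.det_le_det_map hD hX)

omit hTD in
theorem potential_nonneg_of_col (h1 : dual (scaling A B D) 1 = 1) : 0 ≤ potential A B := by
  have h2 : scaling B A (dual D) 1 = 1 := by
    rw [hD.dual_scaling_apply] at h1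
    exact h1
  have := potential_nonneg_of_row hD.dual (hds.dual hD) hB hA h2
  rwa [potential, add_comm] at this

/-- The index starts at `1` because the argument uses a normalized marginal, which the initial
factors need not have. -/
theorem potential_nonneg (n : ℕ) :
    0 ≤ potential (leftFactor T A (n + 1)) (rightFactor T B (n + 1)) := by
  obtain ⟨h₁, h₂, -, -⟩ := OSI_marginals hTD hD hds hA hB (n + 1)
  by_cases hn : Even n
  · refine potential_nonneg_of_row hD hds h₁ h₂ ?_
    rw [← OSI_eq_scaling hTD, OSI_succ_row hTD hD hds hA hB hn]
  · refine potential_nonneg_of_col hD hds h₁ h₂ ?_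
    rw [← OSI_eq_scaling hTD, OSI_succ_col hTD hD hds hA hB hn]

omit hTD hD hds hB in
theorem conjTranspose_mul_self_eq_inv {Z : Mat N} (hZ : A * Z * Aᴴ = 1) : Aᴴ * A = Z⁻¹ := by
  symm
  apply inv_eq_left_inv
  have hA' : IsUnit Aᴴ := (isUnit_iff_isUnit_det _).mpr (by
    rw [det_conjTranspose]; exact hA.star)
  apply hA'.mul_right_cancel
  rw [Matrix.one_mul]
  calc Aᴴ * A * Z * Aᴴ = Aᴴ * (A * Z * Aᴴ) := by simp only [Matrix.mul_assoc]
    _ = Aᴴ := by rw [hZ, Matrix.mul_one]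

omit hTD hD hds hB in
theorem posDef_conjTranspose_mul_self : (Aᴴ * A).PosDef := by
  have := posDef_conjTranspose_mul_mul hA PosDef.one
  rwa [Matrix.mul_one] at this

/-- Over a row step and the column step after it, `X = BᴴB` becomes `(D^*(D(X)⁻¹))⁻¹`. The maps `D`
and `D^*` are unital and monotone, and inversion is applied twice, so `m ≤ X ≤ M` is preserved. -/
theorem rightFactor_bound {m M : ℝ} (hm : 0 < m) (hM : 0 < M)
    (hBm : (Bᴴ * B - (m : ℂ) • 1).PosSemidef) (hBM : ((M : ℂ) • 1 - Bᴴ * B).PosSemidef) (n : ℕ) :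
    ((rightFactor T B n)ᴴ * rightFactor T B n - (m : ℂ) • 1).PosSemidef ∧
      ((M : ℂ) • 1 - (rightFactor T B n)ᴴ * rightFactor T B n).PosSemidef := by
  induction n with
  | zero => exact ⟨hBm, hBM⟩
  | succ n ih =>
    by_cases hn : Even n
    · rw [rightFactor, if_pos hn]
      exact ih
    · obtain ⟨l, rfl⟩ : ∃ l, n = l + 1 := Nat.exists_eq_succ_of_ne_zero (by
        rintro rfl
        exact hn Even.zero)
      have hl : Even l := by
        rw [Nat.even_add_one, not_not] at hn
        exact hn
      obtain ⟨h₁, h₂, -, hc⟩ := OSI_marginals hTD hD hds hA hB (l + 1)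
      obtain ⟨h₁', h₂', -, -⟩ := OSI_marginals hTD hD hds hA hB (l + 2)
      have hrow := OSI_succ_row hTD hD hds hA hB hl
      rw [OSI_eq_scaling hTD, scaling_apply, Matrix.mul_one] at hrow
      have hcol := OSI_succ_col hTD hD hds hA hB hn
      have e1 : leftFactor T A (l + 2) = leftFactor T A (l + 1) := by
        rw [leftFactor, if_neg hn]
      rw [OSI_eq_scaling hTD, hD.dual_scaling_apply, Matrix.mul_one, e1] at hcol
      have hY := conjTranspose_mul_self_eq_inv h₁ hrow
      have hX := conjTranspose_mul_self_eq_inv h₂' hcol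
      have hXpos := posDef_conjTranspose_mul_self h₂
      have hZpos := hds.posDef_map hD hXpos
      have hYm := inv_bound' hZpos (hds.map_bound' hD ih.2)
      have hYM := inv_bound hm (hds.map_bound hD ih.1)
      rw [← hY] at hYm hYM
      have hWm := (hds.dual hD).map_bound hD.dual hYm
      have hWM := (hds.dual hD).map_bound' hD.dual hYM
      have hWpos := posDef_of_bound (inv_pos.mpr hM) hWm
      rw [hX]
      constructor
      · simpa only [inv_inv] using inv_bound' hWpos hWM
      · simpa only [inv_inv] using inv_bound (inv_pos.mpr hM) hWm

end Iteration

/-! ### Exponential convergence -/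

/-- With rows normalized, the remaining marginal error is `B E Bᴴ`, where `E` is the critical point
defect at `X = BᴴB`. So `DS = tr(X E X E) ≥ m² tr E²`, and `tr E²` controls the potential by
`log_det_gap_le`. -/
theorem exists_potential_le_DS {D : Op N} (hD : IsPositive D) (hds : IsDoublyStochastic D)
    (hN : 0 < N) {a : ℝ} (ha1 : a < 1)
    (hgap : ∀ X : Mat N, X.IsHermitian → X.trace = 0 →
      (((D X) ^ 2).trace).re ≤ a * ((X ^ 2).trace).re) {m M : ℝ} (hm : 0 < m) (hM : 0 < M) :
    ∃ K : ℝ, 0 < K ∧ ∀ A B : Mat N, IsUnit A.det → IsUnit B.det → scaling A B D 1 = 1 →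
      (Bᴴ * B - (m : ℂ) • 1).PosSemidef → ((M : ℂ) • 1 - Bᴴ * B).PosSemidef →
      potential A B ≤ K * DS (scaling A B D) := by
  obtain ⟨K, hK, hle⟩ := hds.log_det_gap_le hD hN ha1 hgap hm hM
  refine ⟨K * (m ^ 2)⁻¹, by positivity, fun A B hA hB h1 hBm hBM => ?_⟩
  rw [potential_eq_of_row hA h1]
  refine (hle _ hBm hBM).trans ?_
  rw [mul_assoc]
  refine mul_le_mul_of_nonneg_left ?_ hK.le
  have hrow : A * D (Bᴴ * B) * Aᴴ = 1 := by
    rw [scaling_apply, Matrix.mul_one] at h1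
    exact h1
  have hX := posDef_conjTranspose_mul_self hB
  have hZ := hds.posDef_map hD hX
  set E := dual D ((D (Bᴴ * B))⁻¹) - (Bᴴ * B)⁻¹ with hE
  have hEherm : E.IsHermitian :=
    (hD.dual.isHermitian_map hZ.inv.isHermitian).sub hX.inv.isHermitian
  have hB' : IsUnit Bᴴ.det := by rw [det_conjTranspose]; exact hB.star
  have hmarg : dual (scaling A B D) 1 - 1 = B * E * Bᴴ := by
    rw [hD.dual_scaling_apply, Matrix.mul_one, conjTranspose_mul_self_eq_inv hA hrow, hE,
      Matrix.mul_sub, Matrix.sub_mul]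
    congr 1
    rw [Matrix.mul_inv_rev, ← Matrix.mul_assoc, mul_nonsing_inv _ hB, Matrix.one_mul,
      nonsing_inv_mul _ hB']
  have hDS : DS (scaling A B D) = ((Bᴴ * B * E * (Bᴴ * B) * E).trace).re := by
    have e : ((B * E * Bᴴ) ^ 2).trace = (Bᴴ * B * E * (Bᴴ * B) * E).trace := by
      rw [sq]
      have : B * E * Bᴴ * (B * E * Bᴴ) = B * (E * (Bᴴ * B) * E * Bᴴ) := by
        simp only [Matrix.mul_assoc]
      rw [this, Matrix.trace_mul_comm, Matrix.mul_assoc _ Bᴴ B, Matrix.trace_mul_comm]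
      simp only [Matrix.mul_assoc]
    rw [DS, h1, hmarg, e]
    simp
  rw [hDS, ← div_eq_inv_mul, le_div_iff₀ (by positivity), mul_comm]
  exact trace_sq_le_trace_mul_mul_mul hm hBm hEherm

/-- Geometric decay from a decreasing potential which contracts at every other step. -/
theorem exists_geometric_bound {f φ : ℕ → ℝ} {c K : ℝ} (hc : 0 < c) (hK : 0 < K)
    (hf : ∀ n, 0 ≤ f n) (hφ : ∀ n, 0 ≤ φ (n + 1))
    (h1 : ∀ n, f (n + 1) ≤ c * (φ (n + 1) - φ (n + 2)))
    (h2 : ∀ k, φ (2 * k + 1) ≤ K * f (2 * k + 1)) :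
    ∃ L a : ℝ, 0 ≤ a ∧ a < 1 ∧ ∀ n, f n ≤ L * a ^ n := by
  -- The floor `1 / 4` only keeps `r` positive, so that its square root can be inverted.
  set r : ℝ := max (1 - (c * K)⁻¹) (1 / 4) with hr
  have hcK : 0 < (c * K)⁻¹ := by positivity
  have hr0 : 0 < r := lt_of_lt_of_le (by norm_num) (le_max_right _ _)
  have hr1 : r < 1 := max_lt (by linarith) (by norm_num)
  have hanti : ∀ n, φ (n + 2) ≤ φ (n + 1) := fun n => by
    have h := (hf (n + 1)).trans (h1 n)
    linarith [nonneg_of_mul_nonneg_right h hc]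
  have hstep : ∀ k, φ (2 * k + 2) ≤ r * φ (2 * k + 1) := fun k => by
    have e1 := h1 (2 * k)
    have e2 := h2 k
    have e3 : φ (2 * k + 1) ≤ K * (c * (φ (2 * k + 1) - φ (2 * k + 2))) :=
      e2.trans (mul_le_mul_of_nonneg_left e1 hK.le)
    have e4 : (c * K)⁻¹ * φ (2 * k + 1) ≤ φ (2 * k + 1) - φ (2 * k + 2) := by
      rw [inv_mul_le_iff₀ (by positivity)]
      linarith
    have e5 : (1 - (c * K)⁻¹) * φ (2 * k + 1) ≤ r * φ (2 * k + 1) :=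
      mul_le_mul_of_nonneg_right (le_max_left _ _) (hφ _)
    linarith
  have hodd : ∀ k, φ (2 * k + 1) ≤ r ^ k * φ 1 := fun k => by
    induction k with
    | zero => simp
    | succ k ih =>
      calc φ (2 * (k + 1) + 1) ≤ φ (2 * k + 2) := hanti (2 * k + 1)
        _ ≤ r * φ (2 * k + 1) := hstep k
        _ ≤ r * (r ^ k * φ 1) := mul_le_mul_of_nonneg_left ih hr0.le
        _ = r ^ (k + 1) * φ 1 := by ring
  -- The factor `r` is gained once every two steps, so the rate per step is `√r`.
  set s := √r with hs
  have hs0 : 0 < s := Real.sqrt_pos.mpr hr0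
  have hs1 : s < 1 := by rw [hs, Real.sqrt_lt' one_pos]; simpa using hr1
  have hsr : s ^ 2 = r := Real.sq_sqrt hr0.le
  have hfφ : ∀ n, f (n + 1) ≤ c * φ (n + 1) := fun n =>
    (h1 n).trans (mul_le_mul_of_nonneg_left (by linarith [hφ (n + 1)]) hc.le)
  have hφs : ∀ n, φ (n + 1) ≤ s ^ n * φ 1 * s⁻¹ := fun n => by
    have hφ1 : 0 ≤ φ 1 := hφ 0
    rcases Nat.even_or_odd' n with ⟨k, rfl | rfl⟩
    · calc φ (2 * k + 1) ≤ s ^ (2 * k) * φ 1 * 1 := by rw [pow_mul, hsr, mul_one]; exact hodd k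
        _ ≤ s ^ (2 * k) * φ 1 * s⁻¹ :=
          mul_le_mul_of_nonneg_left ((one_le_inv₀ hs0).mpr hs1.le) (by positivity)
    · calc φ (2 * k + 2) ≤ φ (2 * k + 1) := hanti (2 * k)
        _ ≤ s ^ (2 * k) * φ 1 := by rw [pow_mul, hsr]; exact hodd k
        _ = s ^ (2 * k + 1) * φ 1 * s⁻¹ := by
          field_simp
          ring
  -- The term `f 0` precedes every estimate and is absorbed in the constant; one `s⁻¹` pays for odd
  -- `n`, the other for the index shift.
  refine ⟨max (f 0) (c * φ 1 * (s⁻¹) ^ 2), s, hs0.le, hs1, fun n => ?_⟩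
  cases n with
  | zero =>
    rw [pow_zero, mul_one]
    exact le_max_left _ _
  | succ n =>
    calc f (n + 1) ≤ c * (s ^ n * φ 1 * s⁻¹) :=
          (hfφ n).trans (mul_le_mul_of_nonneg_left (hφs n) hc.le)
      _ = c * φ 1 * (s⁻¹) ^ 2 * s ^ (n + 1) := by
          field_simp
          ring
      _ ≤ _ := mul_le_mul_of_nonneg_right (le_max_right _ _) (by positivity)

theorem OSI_convergence {T : Op N} (hT : IsPositive T) (hind : IsIndecomposable T) (h0 : T ≠ 0) :
    (∀ n : ℕ, HasNonsingularMarginals (OSI T n)) ∧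
      ∃ K a : ℝ, 0 ≤ a ∧ a < 1 ∧ ∀ n : ℕ, DS (OSI T n) ≤ K * a ^ n := by
  obtain ⟨C₁, C₂, h₁, h₂, hds⟩ := hind.exists_scaling hT h0
  have hN : 0 < N := Nat.pos_of_ne_zero fun h => by
    subst h
    exact h0 (Subsingleton.elim _ _)
  have hD := hT.scaling C₁ C₂
  have hTD := (scaling_inv_scaling (T := T) h₁ h₂).symm
  have hA := isUnit_nonsing_inv_det _ h₁
  have hB := isUnit_nonsing_inv_det _ h₂
  obtain ⟨a, -, ha1, hgap⟩ := exists_gap hds hD (hind.scaling h₁ h₂)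
  set D := scaling C₁ C₂ T
  set A := C₁⁻¹
  set B := C₂⁻¹
  have hmarg := OSI_marginals hTD hD hds hA hB
  refine ⟨fun n => ⟨(isUnit_iff_isUnit_det _).mp (hmarg n).2.2.1.isUnit,
    (isUnit_iff_isUnit_det _).mp (hmarg n).2.2.2.isUnit⟩, ?_⟩
  have hX := posDef_conjTranspose_mul_self hB
  obtain ⟨m, hm, hBm⟩ := exists_posDef_bound hX
  obtain ⟨M, hM, hBM⟩ := exists_hermitian_bound hX.isHermitian
  obtain ⟨K, hK, hle⟩ := exists_potential_le_DS hD hds hN ha1 hgap hm hM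
  refine exists_geometric_bound (φ := fun n => potential (leftFactor T A n) (rightFactor T B n))
    (c := 2 * N + 2) (by positivity) hK (DS_OSI_nonneg hTD hD hds hA hB)
    (potential_nonneg hTD hD hds hA hB) (DS_le_potential_sub hTD hD hds hA hB) fun k => ?_
  -- Odd-indexed iterates come from a row step, as the converse bound of the potential by `DS`
  -- requires.
  have hb := rightFactor_bound hTD hD hds hA hB hm hM hBm hBM (2 * k + 1)
  have hrow := OSI_succ_row hTD hD hds hA hB (even_two_mul k)
  rw [OSI_eq_scaling hTD] at hrow ⊢
  exact hle _ _ (hmarg _).1 (hmarg _).2.1 hrow hb.1 hb.2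

end OperatorScaling

theorem theorem4p7 (N : ℕ) (T : OperatorScaling.Op N) (hT : OperatorScaling.IsPositive T) :
    -- scalability to a doubly stochastic operator
    ((∃ C₁ C₂ : OperatorScaling.Mat N, IsUnit C₁.det ∧ IsUnit C₂.det ∧
        OperatorScaling.IsDoublyStochastic (OperatorScaling.scaling C₁ C₂ T)) ↔
      (0 < OperatorScaling.capacity T ∧
        ∃ C : OperatorScaling.Mat N, OperatorScaling.IsMinimizer T C)) ∧
    -- the explicit scaling
    (0 < OperatorScaling.capacity T →
      ∀ C : OperatorScaling.Mat N, OperatorScaling.IsMinimizer T C →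
        OperatorScaling.IsDoublyStochastic
          (OperatorScaling.scaling (OperatorScaling.power (T C) (-1 / 2))
            (OperatorScaling.power C (1 / 2)) T)) ∧
    -- indecomposability and uniqueness of the minimizer
    (OperatorScaling.IsIndecomposable T ↔
      ∃! C : OperatorScaling.Mat N, OperatorScaling.IsMinimizer T C) ∧
    -- indecomposability of doubly stochastic operators
    (OperatorScaling.IsDoublyStochastic T →
      (OperatorScaling.IsIndecomposable T ↔
        ∃ a : ℝ, 0 ≤ a ∧ a < 1 ∧
          ∀ X : OperatorScaling.Mat N, X.IsHermitian → X.trace = 0 →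
            (((T X) ^ 2).trace).re ≤ a * ((X ^ 2).trace).re)) ∧
    -- exponential convergence of operator Sinkhorn scaling
    (OperatorScaling.IsIndecomposable T → T ≠ 0 →
      (∀ n : ℕ, OperatorScaling.HasNonsingularMarginals (OperatorScaling.OSI T n)) ∧
      ∃ K a : ℝ, 0 ≤ a ∧ a < 1 ∧
        ∀ n : ℕ, OperatorScaling.DS (OperatorScaling.OSI T n) ≤ K * a ^ n) :=
  ⟨OperatorScaling.scalable_iff hT,
    fun hcap _ hC => ((OperatorScaling.isMinimizer_iff hT).mp hC).1.scaling_isDoublyStochastic hT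
      (OperatorScaling.posDef_of_capacity_pos hT hcap hC),
    OperatorScaling.indecomposable_iff_unique hT,
    fun hds => OperatorScaling.indecomposable_iff_gap hds hT,
    fun hind h0 => OperatorScaling.OSI_convergence hT hind h0⟩
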